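/- Let $d$ be a nonnegative integer, let $\Lambda\subset\mathbb{R}^d$ be uniformly discrete, i.e. there is $\delta>0$ with $|\lambda-\lambda'|\ge\delta$ for all distinct $\lambda,\lambda'\in\Lambda$, and let $\mu=\sum_{\lambda\in\Lambda}\mu(\lambda)\delta_\lambda$, $\mu(\lambda)\in\mathbb{C}$, be a complex Radon measure that is a tempered distribution, $\mu\in S^*(\mathbb{R}^d)$. Suppose that its Fourier transform $\hat\mu$ (defined by $\hat\mu(\varphi)=\mu(\hat\varphi)$ for Schwartz functions $\varphi$, with $\hat\varphi(y)=\int_{\mathbb{R}^d}\varphi(x)e^{-2\pi i\langle x,y\rangle}\,dx$) is a complex Radon measure that is atomic, i.e. of the form $\sum_{\gamma\in\Gamma}b_\gamma\delta_\gamma$ with $\Gamma\subset\mathbb{R}^d$ countable and $b_\gamma\in\mathbb{C}$, and translation bounded, i.e. $\sup_{t\in\mathbb{R}^d}|\hat\mu|(B(t,1))<\infty$, where $|\hat\mu|$ is the variation of $\hat\mu$ and $B(t,1)$ is the open unit ball with centre $t$. Then for every $\varepsilon>0$ the set $U=\{\lambda\in\Lambda:\ |\mu(\lambda)|\ge\varepsilon\}$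 is a coherent set of frequencies; that is, $U$ is uniformly discrete, and whenever a sequence of finite sums $\sum c_\lambda e^{2\pi i\langle x,\lambda\rangle}$ ($\lambda\in U$, $c_\lambda\in\mathbb{C}$) converges uniformly on every compact subset of $\mathbb{R}^d$, its limit $f$ is almost periodic in the sense of Bohr: $f$ is continuous, and for every $\eta>0$ there is $R>0$ such that every closed ball of radius $R$ in $\mathbb{R}^d$ contains some $\tau$ with $\sup_{t\in\mathbb{R}^d}|f(t+\tau)-f(t)|\le\eta$. -/

import Mathlib

open scoped SchwartzMap FourierTransform CompactlySupported NNReal ENNReal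

noncomputable section

/-- A complex Radon measure on `E`: a linear functional on the space of continuous compactly
supported functions which is bounded with respect to the sup norm on the functions supported in
any fixed compact set. The value `ν f` is the integral of `f` with respect to `ν`. -/
structure ComplexRadonMeasure (E : Type*) [TopologicalSpace E] where
  integral : C_c(E, ℂ) →ₗ[ℂ] ℂ
  bounded : ∀ K : Set E, IsCompact K → ∃ C : ℝ, ∀ (f : C_c(E, ℂ)) (M : ℝ),
    tsupport f ⊆ K → (∀ x, ‖f x‖ ≤ M) → ‖integral f‖ ≤ C * M

namespace ComplexRadonMeasure

section Topological

variable {E : Type*} [TopologicalSpace E]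

/-- The variation `|ν|(U)` of a complex Radon measure on an open set `U`: the supremum of
`|∫ f dν|` over the continuous `f` with compact support inside `U` and `|f| ≤ 1`. -/
def variation (ν : ComplexRadonMeasure E) (U : TopologicalSpace.Opens E) : ℝ≥0∞ :=
  ⨆ (f : C_c(E, ℂ)) (_ : tsupport f ⊆ U) (_ : ∀ x, ‖f x‖ ≤ 1), ‖ν.integral f‖ₑ

/-- `ν = ∑_{x ∈ S} c x δ_x` with a countable set `S`. The sum is unconditional (over `ℂ`: absolutely
convergent) against each test function. -/
def IsSumOfAtoms (ν : ComplexRadonMeasure E) (S : Set E) (c : E → ℂ) : Prop :=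
  S.Countable ∧ ∀ f : C_c(E, ℂ), HasSum (fun x : S => c x * f x) (ν.integral f)

/-- `ν` is atomic: a sum of point masses over some countable set. -/
def IsAtomic (ν : ComplexRadonMeasure E) : Prop :=
  ∃ (S : Set E) (c : E → ℂ), ν.IsSumOfAtoms S c

end Topological

/-- `ν` is translation bounded: the variations on the open balls of radius one are bounded
uniformly in the centre of the ball. -/
def IsTranslationBounded {E : Type*} [PseudoMetricSpace E] (ν : ComplexRadonMeasure E) : Prop :=
  ∃ C : ℝ≥0, ∀ t : E, ν.variation ⟨Metric.ball t 1, Metric.isOpen_ball⟩ ≤ C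

end ComplexRadonMeasure

section Fourier

variable {E : Type*} [NormedAddCommGroup E] [NormedSpace ℝ E]

/-- A compactly supported Schwartz function as a continuous compactly supported function. -/
def SchwartzMap.toCc (φ : 𝓢(E, ℂ)) (hφ : HasCompactSupport φ) : C_c(E, ℂ) :=
  ⟨⟨φ, φ.continuous⟩, hφ⟩

/-- The tempered distribution `T` is the measure `ν`: they agree on all smooth compactly supported
test functions (which are dense in the Schwartz space, so that `ν` determines `T`). -/
def TemperedDistribution.IsMeasure (T : 𝓢'(E, ℂ)) (ν : ComplexRadonMeasure E) : Prop :=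
  ∀ (φ : 𝓢(E, ℂ)) (hφ : HasCompactSupport φ), T φ = ν.integral (φ.toCc hφ)

end Fourier

/-- Distinct points of `S` have distances bounded below by a positive constant. -/
def IsUniformlyDiscrete {E : Type*} [PseudoMetricSpace E] (S : Set E) : Prop :=
  ∃ δ : ℝ, 0 < δ ∧ ∀ x ∈ S, ∀ y ∈ S, x ≠ y → δ ≤ dist x y

/-- Almost periodicity in the sense of Bohr: `f` is continuous and, for each `ε > 0`, the
`ε`-almost periods of `f` are relatively dense. -/
def IsBohrAlmostPeriodic {E : Type*} [SeminormedAddCommGroup E] (f : E → ℂ) : Prop :=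
  Continuous f ∧ ∀ ε : ℝ, 0 < ε → ∃ R : ℝ, 0 < R ∧ ∀ x : E, ∃ τ ∈ Metric.closedBall x R,
    ∀ t : E, ‖f (t + τ) - f t‖ ≤ ε

section Coherent

variable {E : Type*} [NormedAddCommGroup E] [InnerProductSpace ℝ E]

/-- The finite exponential sum `∑ c_λ e^{2π i ⟨x, λ⟩}` with frequencies in `U`. -/
def expSum {U : Set E} (c : U →₀ ℂ) (x : E) : ℂ :=
  c.sum fun l a => a * Complex.exp (2 * Real.pi * Complex.I * (inner ℝ x (l : E) : ℝ))

/-- `U` is a coherent set of frequencies: it is uniformly discrete, and each limit of a sequence of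
finite exponential sums with frequencies in `U`, uniform on every compact set, is almost periodic
in the sense of Bohr. -/
def IsCoherentSetOfFrequencies (U : Set E) : Prop :=
  IsUniformlyDiscrete U ∧
    ∀ (c : ℕ → U →₀ ℂ) (f : E → ℂ),
      (∀ K : Set E, IsCompact K → TendstoUniformlyOn (fun n => expSum (c n)) f Filter.atTop K) →
        IsBohrAlmostPeriodic f

end Coherent

end

/-! Every `f` in the uniform closure `expSpan U` of the trigonometric polynomials with frequencies
in `U` satisfies an estimate `‖f‖ ≤ C * sup |f|` over one fixed ball. Locally uniform convergence of
exponential sums is therefore uniform, and uniform limits of almost periodic functions are almost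
periodic (`isCoherentSetOfFrequencies_of_norm_le`).

For the estimate, take a bump function that equals 1 at the origin and is too narrow to see two
points of `Λ`, and let `ψ` be its inverse Fourier transform. Testing `μ` against modulated
translates of the bump gives `∑ b s * ψ (s + y) * e_l (s + y) = a l * e_l y` for `l ∈ Λ`, where `b
s` are the masses of the Fourier transform (`exists_schwartz_localization`). The combination `M = ∑
b s * ψ s • (translation by s)` thus acts on `expSpan U` with eigenvalues `a l`, all of modulus at
least `ε`. By density, `M f y` also equals `∑ b s * ψ (s + y) * f (s + y)`, in which values of `f`
far from the origin carry little weight, uniformly in `y`, by translation boundedness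
(`IsSumOfAtoms.exists_tsum_weight_le`). If `M` is invertible, the far contribution is absorbed into
`‖f‖` (`exists_norm_le_of_localization`).

Invertibility of `M` is a Wiener-type lemma (`isUnit_tsum_smul_of_le_norm_eigenvalue`). Otherwise a
Gelfand character kills `M` and induces a unimodular character of the group of translations. Since
the eigenvalues of `M` stay away from 0, each frequency is far from that character at one of
finitely many translations. A product of circle cutoffs then annihilates every exponential, hence is
zero, although the Gelfand character does not vanish on it. -/

/-! ### Absolutely convergent cutoffs on the unit circle -/

/-- The Fourier series of the second periodic Bernoulli function. -/
theorem hasSum_exp_div_sq (x : ℝ) (hx : x ∈ Set.Icc (0 : ℝ) 1) :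
    HasSum (fun n : ℤ => 1 / (n : ℂ) ^ 2 * Complex.exp (2 * Real.pi * Complex.I * n * x))
      (2 * (Real.pi : ℂ) ^ 2 * ((x : ℂ) ^ 2 - x + 6⁻¹)) := by
  have h := hasSum_one_div_pow_mul_fourier_mul_bernoulliFun (k := 2) le_rfl hx
  have e : -(2 * (Real.pi : ℂ) * Complex.I) ^ 2 / (Nat.factorial 2 : ℕ) * (bernoulliFun 2 x : ℝ)
      = 2 * Real.pi ^ 2 * (x ^ 2 - x + 6⁻¹) := by
    rw [bernoulliFun_two]
    push_cast [Nat.factorial]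
    linear_combination (-2 * (Real.pi : ℂ) ^ 2 * (x ^ 2 - x + 6⁻¹)) * Complex.I_sq
  rw [e] at h
  convert h using 3 with n
  rw [fourier_coe_apply]
  simp

theorem exists_exp_eq_of_norm_eq_one {z : ℂ} (hz : ‖z‖ = 1) :
    ∃ x ∈ Set.Icc (0 : ℝ) 1, z = Complex.exp (2 * Real.pi * Complex.I * x) := by
  refine ⟨Int.fract (z.arg / (2 * Real.pi)), ⟨Int.fract_nonneg _, (Int.fract_lt_one _).le⟩, ?_⟩
  have h1 : z = Complex.exp (z.arg * Complex.I) := by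
    conv_lhs => rw [← Complex.norm_mul_exp_arg_mul_I z]
    simp [hz]
  conv_lhs => rw [h1]
  rw [Complex.exp_eq_exp_iff_exists_int]
  refine ⟨⌊z.arg / (2 * Real.pi)⌋, ?_⟩
  rw [Int.fract]
  push_cast
  have : (Real.pi : ℂ) ≠ 0 := by exact_mod_cast Real.pi_ne_zero
  field_simp
  ring

theorem norm_exp_two_pi_sub_one_le (x : ℝ) :
    ‖Complex.exp (2 * Real.pi * Complex.I * x) - 1‖ ≤ 2 * Real.pi * |x| := by
  have h := Real.norm_exp_I_mul_ofReal_sub_one_le (x := 2 * Real.pi * x)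
  rw [Real.norm_eq_abs, abs_mul, abs_of_pos Real.two_pi_pos] at h
  convert h using 4
  push_cast
  ring

/-- There are absolutely convergent Fourier series vanishing outside an arbitrarily small
neighbourhood of the point `1` of the unit circle, but not at `1`. -/
theorem exists_circle_cutoff {κ : ℝ} (hκ : 0 < κ) :
    ∃ t : ℤ → ℂ, Summable (fun n => ‖t n‖) ∧
      (∀ z : ℂ, ‖z‖ = 1 → κ ≤ ‖z - 1‖ → HasSum (fun n => t n * z ^ n) 0) ∧
      ∃ s ≠ 0, HasSum t s := by
  have hπ : (Real.pi : ℂ) ≠ 0 := by exact_mod_cast Real.pi_ne_zero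
  obtain ⟨r, hr0, hr1, hrκ⟩ : ∃ r : ℝ, 0 < r ∧ r ≤ 1 ∧ 2 * Real.pi * r ≤ κ := by
    refine ⟨min (κ / (2 * Real.pi)) 1, ?_, min_le_right _ _, ?_⟩
    · have := Real.pi_pos; positivity
    · calc _ ≤ 2 * Real.pi * (κ / (2 * Real.pi)) := by
            gcongr; exact min_le_left _ _
        _ = κ := by field_simp
  set ex : ℤ → ℝ → ℂ := fun n x => Complex.exp (2 * Real.pi * Complex.I * n * x) with hex
  have ex_add (n : ℤ) (x y : ℝ) : ex n (x + y) = ex n x * ex n y := by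
    simp only [hex, ← Complex.exp_add]
    congr 1
    push_cast
    ring
  have ex_neg (n : ℤ) (x : ℝ) : ex n (1 + x) = ex n x := by
    simp only [hex]
    rw [Complex.exp_eq_exp_iff_exists_int]
    exact ⟨n, by push_cast; ring⟩
  -- Second difference with step `r` of the Bernoulli series. For a quadratic polynomial it is the
  -- constant `4π²r²`, which the extra term at `n = 0` cancels; only wrapping around the circle
  -- leaves something nonzero. At `n = 0` the first summand vanishes because `1 / 0 = 0`.
  set t : ℤ → ℂ := fun n => 1 / (n : ℂ) ^ 2 * (ex n r + ex n (-r) - 2) +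
    if n = 0 then (-4 * Real.pi ^ 2 * r ^ 2 : ℂ) else 0 with ht
  -- `p` and `m` represent `x + r` and `x - r` in `[0, 1]`. The left shift is only required modulo
  -- 1, so that `x = 0` is allowed.
  have key (x p m : ℝ) (hx : x ∈ Set.Icc (0 : ℝ) 1) (hp : p ∈ Set.Icc (0 : ℝ) 1)
      (hm : m ∈ Set.Icc (0 : ℝ) 1) (hp' : p = x + r) (hm' : ∀ n, ex n m = ex n (x + -r)) :
      HasSum (fun n => t n * ex n x) (2 * Real.pi ^ 2 * ((p ^ 2 - p) + (m ^ 2 - m)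
        - 2 * (x ^ 2 - x)) - 4 * Real.pi ^ 2 * r ^ 2) := by
    have h1 := hasSum_exp_div_sq x hx
    have h2 := hasSum_exp_div_sq p hp
    have h3 := hasSum_exp_div_sq m hm
    have h4 := hasSum_ite_eq (0 : ℤ) (-4 * Real.pi ^ 2 * r ^ 2 : ℂ)
    have h5 := ((h2.add h3).sub (h1.mul_left 2)).add h4
    have hv : 2 * (Real.pi : ℂ) ^ 2 * (((p : ℂ) ^ 2 - p) + ((m : ℂ) ^ 2 - m)
        - 2 * ((x : ℂ) ^ 2 - x)) - 4 * Real.pi ^ 2 * r ^ 2 =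
        2 * Real.pi ^ 2 * (p ^ 2 - p + 6⁻¹) + 2 * Real.pi ^ 2 * (m ^ 2 - m + 6⁻¹) -
        2 * (2 * Real.pi ^ 2 * (x ^ 2 - x + 6⁻¹)) + -4 * Real.pi ^ 2 * r ^ 2 := by ring
    rw [hv]
    suffices hf : ∀ n, t n * ex n x = _ from (funext hf : (fun n => t n * ex n x) = _) ▸ h5
    intro n
    have e1 : ex n p = ex n x * ex n r := by rw [hp', ex_add]
    have e2 : ex n m = ex n x * ex n (-r) := by rw [hm', ex_add]
    change _ = 1 / (n : ℂ) ^ 2 * ex n p + 1 / (n : ℂ) ^ 2 * ex n m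
      - 2 * (1 / (n : ℂ) ^ 2 * ex n x) + _
    rw [e1, e2]
    simp only [ht]
    by_cases hn : n = 0
    · subst hn
      simp [hex]
    · simp only [hn, if_false]
      ring
  refine ⟨t, ?_, ?_, ?_⟩
  · have hs : Summable (fun n : ℤ => 4 * |1 / (n : ℝ) ^ 2| +
        ‖if n = 0 then (-4 * Real.pi ^ 2 * r ^ 2 : ℂ) else 0‖) := by
      refine ((Real.summable_one_div_int_pow.mpr one_lt_two).abs.mul_left 4).add ?_
      exact (hasSum_ite_eq (0 : ℤ) (-4 * Real.pi ^ 2 * r ^ 2 : ℂ)).summable.norm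
    refine hs.of_nonneg_of_le (fun n => norm_nonneg _) fun n => ?_
    refine (norm_add_le _ _).trans (add_le_add ?_ le_rfl)
    have hn (x : ℝ) : ‖ex n x‖ = 1 := by
      rw [hex]
      simp only
      rw [show 2 * (Real.pi : ℂ) * Complex.I * n * x = ((2 * Real.pi * n * x : ℝ) : ℂ) * Complex.I
        by push_cast; ring, Complex.norm_exp_ofReal_mul_I]
    rw [norm_mul, mul_comm]
    gcongr
    · calc _ ≤ ‖ex n r‖ + ‖ex n (-r)‖ + ‖(2 : ℂ)‖ :=
            (norm_sub_le _ _).trans (add_le_add (norm_add_le _ _) le_rfl)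
        _ = 4 := by rw [hn, hn]; norm_num
    · simp
  · intro z hz hzκ
    obtain ⟨x, hx, rfl⟩ := exists_exp_eq_of_norm_eq_one hz
    -- Being `κ`-far from 1 keeps `x` at distance at least `r` from both endpoints, so neither shift
    -- wraps around.
    have h1 : r ≤ x := by
      have := hrκ.trans (hzκ.trans (norm_exp_two_pi_sub_one_le x))
      rw [abs_of_nonneg hx.1] at this
      exact le_of_mul_le_mul_left this Real.two_pi_pos
    have h2 : r ≤ 1 - x := by
      have e : Complex.exp (2 * Real.pi * Complex.I * x) =
          Complex.exp (2 * Real.pi * Complex.I * (x - 1 : ℝ)) := by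
        rw [Complex.exp_eq_exp_iff_exists_int]
        exact ⟨1, by push_cast; ring⟩
      have := hrκ.trans (hzκ.trans (e ▸ norm_exp_two_pi_sub_one_le (x - 1)))
      rw [abs_of_nonpos (by linarith [hx.2])] at this
      have := le_of_mul_le_mul_left this Real.two_pi_pos
      linarith
    convert key x (x + r) (x + -r) hx ⟨by linarith, by linarith⟩ ⟨by linarith, by linarith [hx.2]⟩
      rfl (fun n => rfl) using 1
    · funext n
      rw [← Complex.exp_int_mul]
      congr 2
      ring
    · push_cast
      ring
  -- At `x = 0` the left shift wraps to `1 - r`, and the sum is `-4π²r ≠ 0`.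
  · have h := key 0 r (1 + -r) (by simp) ⟨hr0.le, hr1⟩ ⟨by linarith, by linarith⟩ (by simp)
      (fun n => by rw [ex_neg, zero_add])
    have e : 2 * (Real.pi : ℂ) ^ 2 * ((r ^ 2 - r) + (((1 + -r : ℝ) : ℂ) ^ 2 - (1 + -r : ℝ))
        - 2 * ((0 : ℝ) ^ 2 - (0 : ℝ))) - 4 * Real.pi ^ 2 * r ^ 2 = -4 * Real.pi ^ 2 * r := by
      push_cast
      ring
    rw [e] at h
    have : (r : ℂ) ≠ 0 := by exact_mod_cast hr0.ne'
    exact ⟨-4 * Real.pi ^ 2 * r, by simp [hπ, this], by simpa [hex] using h⟩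

/-! ### A Wiener lemma through Gelfand theory -/

/-- A contractive family combined with absolutely summable coefficients is summable, and the sum is
preserved by continuous linear maps. -/
theorem hasSum_smul_map_of_norm_le_one {J V W : Type*} [NormedAddCommGroup V] [NormedSpace ℂ V]
    [CompleteSpace V] [AddCommMonoid W] [TopologicalSpace W] [Module ℂ W] {c : J → ℂ}
    (hc : Summable fun j => ‖c j‖) {v : J → V} (hv : ∀ j, ‖v j‖ ≤ 1) (L : V →L[ℂ] W) :
    HasSum (fun j => c j • L (v j)) (L (∑' j, c j • v j)) := by
  have h : HasSum (fun j => c j • v j) (∑' j, c j • v j) := by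
    refine (Summable.of_norm_bounded hc fun j => ?_).hasSum
    rw [norm_smul]
    exact mul_le_of_le_one_right (norm_nonneg _) (hv j)
  simpa only [Function.comp_def, map_smul] using h.map L L.continuous

/-- An additive group represented by contractions in a commutative Banach algebra, with a separating
family of eigenvectors. If an absolutely convergent combination of the contractions has eigenvalues
bounded away from zero, then it is invertible. -/
theorem isUnit_tsum_smul_of_le_norm_eigenvalue_of_comm {A X : Type*} [NormedCommRing A]
    [NormedAlgebra ℂ A] [CompleteSpace A] [NormedAddCommGroup X] [NormedSpace ℂ X] {G : Type*}
    [AddCommGroup G] {ι : Type*} (ev : ι → A →L[ℂ] X) (hinj : ∀ x, (∀ i, ev i x = 0) → x = 0)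
    (hideal : ∀ i x y, ev i y = 0 → ev i (x * y) = 0) (e : ι → X)
    (T : AddChar G A) (hT : ∀ x, ‖T x‖ ≤ 1) (χ : ι → AddChar G ℂ)
    (hχ : ∀ i x, ‖χ i x‖ = 1) (hTχ : ∀ i x, ev i (T x) = χ i x • e i)
    {S : Type*} (B : S → ℂ) (hB : Summable fun s => ‖B s‖) (γ : S → G) {ε : ℝ} (hε : 0 < ε)
    (hM : ∀ i, ε ≤ ‖∑' s, B s * χ i (γ s)‖) :
    IsUnit (∑' s, B s • T (γ s)) := by
  classical
  by_contra hnu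
  obtain ⟨ω, hω⟩ := WeakDual.CharacterSpace.exists_apply_eq_zero hnu
  let ωL : A →L[ℂ] ℂ := WeakDual.CharacterSpace.toCLM ω
  let Ω : AddChar G ℂ :=
    { toFun := fun x => ω (T x)
      map_zero_eq_one' := by rw [T.map_zero_eq_one, map_one]
      map_add_eq_mul' := fun x y => by rw [T.map_add_eq_mul, map_mul] }
  have hΩle (x : G) : ‖Ω x‖ ≤ 1 := by
    refine (AlgHom.norm_apply_le_self_mul_norm_one ω (T x)).trans ?_
    rw [← T.map_zero_eq_one]
    exact mul_le_one₀ (hT x) (norm_nonneg _) (hT 0)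
  -- `Ω x` and `Ω (-x)` have modulus at most 1 and product 1.
  have hΩ (x : G) : ‖Ω x‖ = 1 := by
    have h1 : ‖Ω x‖ * ‖Ω (-x)‖ = 1 := by
      rw [← norm_mul, ← AddChar.map_add_eq_mul, add_neg_cancel, AddChar.map_zero_eq_one, norm_one]
    nlinarith [hΩle x, hΩle (-x), norm_nonneg (Ω x), norm_nonneg (Ω (-x))]
  have hΩ0 (x : G) : Ω x ≠ 0 := by
    rw [← norm_pos_iff, hΩ]; exact one_pos
  have hΩM : HasSum (fun s => B s * Ω (γ s)) 0 :=
    hω ▸ hasSum_smul_map_of_norm_le_one hB (fun s => hT (γ s)) ωL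
  obtain ⟨F, hF⟩ : ∃ F : Finset S, ∑' s : {s // s ∉ F}, ‖B s‖ < ε / 4 := by
    have := (tendsto_order.mp (tendsto_tsum_compl_atTop_zero fun s => ‖B s‖)).2 (ε / 4)
      (by positivity)
    exact this.exists
  -- The added 1 keeps `N` positive. With this `κ`, being `κ`-close on `F` costs at most `ε / 4`
  -- there and `2 * (ε / 4)` on the tail, hence less than `ε` in total.
  set N : ℝ := ∑ s ∈ F, ‖B s‖ + 1 with hN
  have hN0 : 0 < N := by positivity
  set κ : ℝ := ε / 4 / N with hκdef
  have hκ : 0 < κ := by positivity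
  -- If `χ i` were close to `Ω` on all of `F`, the `i`-th eigenvalue would be within `3ε / 4` of the
  -- value 0 of `ω`.
  have hfar (i : ι) : ∃ s ∈ F, κ ≤ ‖χ i (γ s) - Ω (γ s)‖ := by
    by_contra! hcon
    have hd : ∀ s, ‖B s * (χ i (γ s) - Ω (γ s))‖ ≤ 2 * ‖B s‖ := fun s => by
      rw [norm_mul, mul_comm]
      gcongr
      exact (norm_sub_le _ _).trans (by rw [hχ, hΩ]; norm_num)
    have hsd : Summable fun s => ‖B s * (χ i (γ s) - Ω (γ s))‖ :=
      (hB.mul_left 2).of_nonneg_of_le (fun _ => norm_nonneg _) hd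
    have hsχ : Summable fun s => B s * χ i (γ s) :=
      .of_norm (by simpa [hχ] using hB)
    have e1 : ∑' s, B s * χ i (γ s) = ∑' s, B s * (χ i (γ s) - Ω (γ s)) := by
      have := hsχ.tsum_sub hΩM.summable
      rw [hΩM.tsum_eq, sub_zero] at this
      rw [← this]
      simp only [mul_sub]
    have e2 : ‖∑' s, B s * χ i (γ s)‖ ≤ ε / 4 + 2 * (ε / 4) := by
      rw [e1]
      refine (norm_tsum_le_tsum_norm hsd).trans ?_
      rw [← hsd.sum_add_tsum_subtype_compl F]
      gcongr
      · calc ∑ s ∈ F, ‖B s * (χ i (γ s) - Ω (γ s))‖ ≤ ∑ s ∈ F, ‖B s‖ * κ := by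
              refine Finset.sum_le_sum fun s hs => ?_
              rw [norm_mul]
              gcongr
              exact (hcon s hs).le
          _ = (N - 1) * κ := by rw [← Finset.sum_mul, hN]; ring
          _ ≤ N * κ := by gcongr; linarith
          _ = ε / 4 := by rw [hκdef]; field_simp
      · have hs1 : Summable fun s : {s // s ∉ F} => ‖B s * (χ i (γ s) - Ω (γ s))‖ :=
          hsd.comp_injective Subtype.val_injective
        have hs2 : Summable fun s : {s // s ∉ F} => 2 * ‖B s‖ :=
          (hB.mul_left 2).comp_injective Subtype.val_injective
        have hle (s : {s // s ∉ F}) : ‖B s * (χ i (γ s) - Ω (γ s))‖ ≤ 2 * ‖B s‖ := hd s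
        refine (Summable.tsum_le_tsum hle hs1 hs2).trans ?_
        rw [tsum_mul_left]
        gcongr
    linarith [hM i]
  obtain ⟨t, ht, hcut, σ, hσ, hsσ⟩ := exists_circle_cutoff hκ
  have htΩ (x : G) : Summable fun n : ℤ => ‖t n * (Ω x)⁻¹ ^ n‖ := by
    simpa [norm_mul, norm_zpow, hΩ] using ht
  -- The circle cutoff evaluated at `(Ω x)⁻¹ • T x`: `ω` sends it to `σ ≠ 0`, while it kills each
  -- eigenvector whose character is `κ`-far from `Ω` at `x`.
  let Q : G → A := fun x => ∑' n : ℤ, (t n * (Ω x)⁻¹ ^ n) • T (n • x)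
  have hωQ (x : G) : ω (Q x) = σ := by
    refine (hasSum_smul_map_of_norm_le_one (htΩ x) (fun n : ℤ => hT (n • x)) ωL).unique ?_
    convert hsσ using 2 with n
    change _ * Ω (n • x) = _
    rw [AddChar.map_zsmul_eq_zpow, mul_assoc, ← mul_zpow, inv_mul_cancel₀ (hΩ0 x), one_zpow,
      mul_one]
  have hQe (i : ι) (x : G) (hx : κ ≤ ‖χ i x - Ω x‖) : ev i (Q x) = 0 := by
    have h1 := hasSum_smul_map_of_norm_le_one (htΩ x) (fun n : ℤ => hT (n • x)) (ev i)
    have h2 := (hcut ((Ω x)⁻¹ * χ i x) (by rw [norm_mul, norm_inv, hΩ, hχ]; norm_num) (by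
      have : (Ω x)⁻¹ * χ i x - 1 = (Ω x)⁻¹ * (χ i x - Ω x) := by
        rw [mul_sub, inv_mul_cancel₀ (hΩ0 x)]
      rwa [this, norm_mul, norm_inv, hΩ, inv_one, one_mul])).smul_const (e i)
    rw [zero_smul] at h2
    refine h1.unique ?_
    convert h2 using 2 with n
    rw [hTχ, smul_smul, AddChar.map_zsmul_eq_zpow, mul_zpow, mul_assoc]
  have hprod : ∏ s ∈ F, Q (γ s) = 0 := by
    refine hinj _ fun i => ?_
    obtain ⟨s, hs, hsκ⟩ := hfar i
    rw [← Finset.prod_erase_mul F _ hs]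
    exact hideal i _ _ (hQe i _ hsκ)
  have := congrArg ω hprod
  rw [map_prod, map_zero] at this
  simp only [hωQ, Finset.prod_const] at this
  exact pow_ne_zero _ hσ this

/-! ### Operators diagonal in a total family -/

section Diagonal

variable {X : Type*} [NormedAddCommGroup X] [NormedSpace ℂ X] {ι : Type*}

/-- The operators having all vectors of a given family as eigenvectors. -/
def diagonalSubalgebra (e : ι → X) : Subalgebra ℂ (X →L[ℂ] X) where
  carrier := {S | ∀ i, S (e i) ∈ Submodule.span ℂ {e i}}
  mul_mem' := by
    intro S S' hS hS' i
    obtain ⟨c, hc⟩ := Submodule.mem_span_singleton.mp (hS' i)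
    change S (S' (e i)) ∈ _
    rw [← hc, map_smul]
    exact Submodule.smul_mem _ _ (hS i)
  add_mem' := fun hS hS' i => Submodule.add_mem _ (hS i) (hS' i)
  algebraMap_mem' := by
    intro c i
    rw [Algebra.algebraMap_eq_smul_one]
    change c • e i ∈ _
    exact Submodule.smul_mem _ _ (Submodule.mem_span_singleton_self _)

theorem mem_diagonalSubalgebra {e : ι → X} {S : X →L[ℂ] X} :
    S ∈ diagonalSubalgebra e ↔ ∀ i, S (e i) ∈ Submodule.span ℂ {e i} := Iff.rfl

theorem isClosed_diagonalSubalgebra (e : ι → X) :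
    IsClosed (diagonalSubalgebra e : Set (X →L[ℂ] X)) := by
  have : (diagonalSubalgebra e : Set (X →L[ℂ] X)) =
      ⋂ i, (fun S : X →L[ℂ] X => S (e i)) ⁻¹' (Submodule.span ℂ {e i} : Set X) := by
    ext S
    simp [mem_diagonalSubalgebra]
  rw [this]
  exact isClosed_iInter fun i => (Submodule.closed_of_finiteDimensional _).preimage
    (ContinuousLinearMap.apply ℂ X (e i)).continuous

theorem ContinuousLinearMap.ext_of_total {Y : Type*} [NormedAddCommGroup Y] [NormedSpace ℂ Y]
    {e : ι → X} (he : (Submodule.span ℂ (Set.range e)).topologicalClosure = ⊤)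
    {S S' : X →L[ℂ] Y} (h : ∀ i, S (e i) = S' (e i)) : S = S' := by
  refine ContinuousLinearMap.ext_on (Submodule.dense_iff_topologicalClosure_eq_top.mpr he) ?_
  rintro _ ⟨i, rfl⟩
  exact h i

/-- Scalars commute on each common eigenvector, and totality determines a continuous operator from
its values there. This is what makes Gelfand theory applicable. -/
theorem diagonalSubalgebra_mul_comm {e : ι → X}
    (he : (Submodule.span ℂ (Set.range e)).topologicalClosure = ⊤)
    (S S' : diagonalSubalgebra e) : S * S' = S' * S := by
  refine Subtype.ext (ContinuousLinearMap.ext_of_total he fun i => ?_)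
  obtain ⟨c, hc⟩ := Submodule.mem_span_singleton.mp (S.2 i)
  obtain ⟨c', hc'⟩ := Submodule.mem_span_singleton.mp (S'.2 i)
  change S.1 (S'.1 (e i)) = S'.1 (S.1 (e i))
  rw [← hc, ← hc', map_smul, map_smul, ← hc, ← hc', smul_comm]

/-- A family of diagonal operators representing an additive group by contractions. If an absolutely
convergent combination of them has eigenvalues bounded away from zero, then it is invertible. -/
theorem isUnit_tsum_smul_of_le_norm_eigenvalue [CompleteSpace X] {G : Type*} [AddCommGroup G]
    {e : ι → X} (he : (Submodule.span ℂ (Set.range e)).topologicalClosure = ⊤)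
    (T : AddChar G (X →L[ℂ] X)) (hT : ∀ x, ‖T x‖ ≤ 1) (χ : ι → AddChar G ℂ)
    (hχ : ∀ i x, ‖χ i x‖ = 1) (hTχ : ∀ i x, T x (e i) = χ i x • e i)
    {S : Type*} (B : S → ℂ) (hB : Summable fun s => ‖B s‖) (γ : S → G) {ε : ℝ} (hε : 0 < ε)
    (hM : ∀ i, ε ≤ ‖∑' s, B s * χ i (γ s)‖) :
    IsUnit (∑' s, B s • T (γ s)) := by
  let D := diagonalSubalgebra e
  let _ : NormedCommRing D :=
    { (inferInstance : NormedRing D) with mul_comm := diagonalSubalgebra_mul_comm he }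
  have : CompleteSpace D := (isClosed_diagonalSubalgebra e).completeSpace_coe
  let TD : AddChar G D :=
    { toFun := fun x => ⟨T x, fun i => by
        rw [hTχ]; exact Submodule.smul_mem _ _ (Submodule.mem_span_singleton_self _)⟩
      map_zero_eq_one' := Subtype.ext T.map_zero_eq_one
      map_add_eq_mul' := fun x y => Subtype.ext (T.map_add_eq_mul x y) }
  let val : D →L[ℂ] X →L[ℂ] X := D.toSubmodule.subtypeL
  have hsum := hasSum_smul_map_of_norm_le_one hB (v := fun s => TD (γ s)) (fun s => hT (γ s)) val
  let ev : ι → D →L[ℂ] X := fun i => (ContinuousLinearMap.apply ℂ X (e i)).comp val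
  have hinj (x : D) (hx : ∀ i, ev i x = 0) : x = 0 :=
    Subtype.ext (ContinuousLinearMap.ext_of_total he hx)
  have hideal (i : ι) (x y : D) (hy : ev i y = 0) : ev i (x * y) = 0 := by
    change x.1 (y.1 (e i)) = 0
    rw [show y.1 (e i) = 0 from hy, map_zero]
  have hD : IsUnit (∑' s, B s • TD (γ s)) :=
    isUnit_tsum_smul_of_le_norm_eigenvalue_of_comm ev hinj hideal
      e TD hT χ hχ hTχ B hB γ hε hM
  have heq : ∑' s, B s • T (γ s) = D.val (∑' s, B s • TD (γ s)) := hsum.tsum_eq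
  rw [heq]
  exact hD.map D.val

end Diagonal

/-! ### Test functions interpolating at finitely many points -/

section TestFunctions

variable {E : Type*} [PseudoMetricSpace E] [ProperSpace E]

theorem hasCompactSupport_of_eq_zero_of_lt_dist {β : Type*} [Zero β] {f : E → β} (t : E) (R : ℝ)
    (hf : ∀ x, R < dist x t → f x = 0) : HasCompactSupport f :=
  HasCompactSupport.intro (isCompact_closedBall t R) fun x hx =>
    hf x (by simpa [Metric.mem_closedBall] using hx)

theorem exists_cc_one_le_on_ball (t : E) :
    ∃ f : C_c(E, ℂ), ∀ x ∈ Metric.ball t 1, 1 ≤ ‖f x‖ := by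
  refine ⟨⟨⟨fun x => ((max 0 (2 - dist x t) : ℝ) : ℂ), by fun_prop⟩, ?_⟩, fun x hx => ?_⟩
  · refine hasCompactSupport_of_eq_zero_of_lt_dist t 2 fun x hx => ?_
    simp only [Complex.ofReal_eq_zero]
    exact max_eq_left (by linarith)
  · change 1 ≤ ‖((max 0 (2 - dist x t) : ℝ) : ℂ)‖
    rw [Complex.norm_real, Real.norm_eq_abs]
    rw [Metric.mem_ball] at hx
    exact le_trans (le_trans (by linarith) (le_max_right 0 _)) (le_abs_self _)

/-- A test function supported in an open set with prescribed values of modulus at most one at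
finitely many points of it, and vanishing at finitely many others. -/
theorem exists_cc_interpolation {E : Type*} [MetricSpace E] [ProperSpace E] {U : Set E}
    (hU : IsOpen U) (F G : Finset E) (hFU : ↑F ⊆ U) (p : E → ℂ) (hp : ∀ x, ‖p x‖ ≤ 1) :
    ∃ f : C_c(E, ℂ), tsupport f ⊆ U ∧ (∀ x, ‖f x‖ ≤ 1) ∧ (∀ x ∈ F, f x = p x) ∧
      ∀ x ∈ G, x ∉ F → f x = 0 := by
  classical
  obtain ⟨r, hr, hrsep, hrU⟩ : ∃ r : ℝ, 0 < r ∧ (∀ x ∈ F, ∀ y ∈ F ∪ G, x ≠ y → 2 * r ≤ dist x y) ∧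
      ∀ x ∈ F, Metric.closedBall x r ⊆ U := by
    have h1 : ∀ᶠ r in nhdsWithin (0 : ℝ) (Set.Ioi 0),
        ∀ x ∈ F, ∀ y ∈ F ∪ G, x ≠ y → 2 * r ≤ dist x y := by
      rw [Filter.eventually_all_finset]
      intro x _
      rw [Filter.eventually_all_finset]
      intro y _
      by_cases hxy : x = y
      · simp [hxy]
      · filter_upwards [Ioo_mem_nhdsGT (show 0 < dist x y / 2 by have := dist_pos.mpr hxy; linarith)]
          with r hr _
        linarith [hr.2]
    have h2 : ∀ᶠ r in nhdsWithin (0 : ℝ) (Set.Ioi 0), ∀ x ∈ F, Metric.closedBall x r ⊆ U := by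
      rw [Filter.eventually_all_finset]
      intro x hx
      obtain ⟨ρ, hρ, hρU⟩ := Metric.isOpen_iff.mp hU x (hFU hx)
      filter_upwards [Ioo_mem_nhdsGT hρ] with r hr
      exact (Metric.closedBall_subset_ball hr.2).trans hρU
    obtain ⟨r, hr, h⟩ := (((h1.and h2).and self_mem_nhdsWithin)).exists.imp fun r h =>
      And.intro h.2 h.1
    exact ⟨r, hr, h⟩
  let g : E → ℂ := fun x => ∑ s ∈ F, p s * ((max 0 (1 - dist x s / r) : ℝ) : ℂ)
  have hg : Continuous g := by fun_prop
  have hterm (x s : E) (h : r ≤ dist x s) : p s * ((max 0 (1 - dist x s / r) : ℝ) : ℂ) = 0 := by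
    have : 1 ≤ dist x s / r := (one_le_div hr).mpr h
    rw [max_eq_left (by linarith), Complex.ofReal_zero, mul_zero]
  have hsingle (x s : E) (hs : s ∈ F) (h : dist x s < r) :
      g x = p s * ((max 0 (1 - dist x s / r) : ℝ) : ℂ) := by
    refine Finset.sum_eq_single_of_mem s hs fun s' hs' hne => hterm _ _ ?_
    have := hrsep s hs s' (Finset.mem_union_left _ hs') hne.symm
    have := dist_triangle_left s s' x
    linarith
  have hzero (x : E) (h : ∀ s ∈ F, r ≤ dist x s) : g x = 0 :=
    Finset.sum_eq_zero fun s hs => hterm _ _ (h s hs)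
  have hsupp : tsupport g ⊆ ⋃ s ∈ F, Metric.closedBall s r := by
    refine closure_minimal ?_ (F.finite_toSet.isClosed_biUnion fun _ _ => Metric.isClosed_closedBall)
    intro x hx
    by_contra hcon
    refine hx (hzero x fun s hs => ?_)
    simp only [Set.mem_iUnion, Metric.mem_closedBall, not_exists, not_le] at hcon
    exact (hcon s hs).le
  have hcpt : IsCompact (⋃ s ∈ F, Metric.closedBall s r) :=
    F.finite_toSet.isCompact_biUnion fun _ _ => isCompact_closedBall _ _
  refine ⟨⟨⟨g, hg⟩, hcpt.of_isClosed_subset (isClosed_tsupport g) hsupp⟩,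
    hsupp.trans (Set.iUnion₂_subset hrU), fun x => ?_, fun x hx => ?_, fun x hx hxF => ?_⟩
  · change ‖g x‖ ≤ 1
    by_cases h : ∃ s ∈ F, dist x s < r
    · obtain ⟨s, hs, hd⟩ := h
      rw [hsingle x s hs hd, norm_mul, Complex.norm_real]
      refine mul_le_one₀ (hp s) (norm_nonneg _) ?_
      rw [Real.norm_eq_abs, abs_of_nonneg (le_max_left _ _)]
      exact max_le zero_le_one (by have : 0 ≤ dist x s / r := by positivity
                                   linarith)
    · push Not at h
      rw [hzero x h, norm_zero]
      exact zero_le_one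
  · change g x = p x
    rw [hsingle x x hx (by simpa using hr)]
    simp
  · change g x = 0
    refine hzero x fun s hs => ?_
    have := hrsep s hs x (Finset.mem_union_right _ hx) (fun h => hxF (h ▸ hs))
    rw [dist_comm]
    linarith

end TestFunctions

/-! ### Masses of translation bounded atomic measures -/

namespace ComplexRadonMeasure

/-- The variation of a sum of atoms on a unit ball bounds the sum of the moduli of the masses. -/
theorem IsSumOfAtoms.tsum_enorm_le_variation {E : Type*} [MetricSpace E] [ProperSpace E]
    {ν : ComplexRadonMeasure E} {S : Set E} {b : E → ℂ} (h : ν.IsSumOfAtoms S b) (t : E) :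
    ∑' s : S, (Metric.ball t 1).indicator (fun x => ‖b x‖ₑ) (s : E) ≤
      ν.variation ⟨Metric.ball t 1, Metric.isOpen_ball⟩ := by
  classical
  rw [ENNReal.tsum_eq_iSup_sum]
  refine iSup_le fun F => ?_
  refine ENNReal.le_of_forall_pos_le_add fun κ hκ _ => ?_
  -- The test function `f` is built after the finite set `G`, so its tail outside `G` must be
  -- controlled in advance. `f₀` dominates every admissible `f`.
  obtain ⟨f₀, hf₀⟩ := exists_cc_one_le_on_ball t
  have hs₀ := (h.2 f₀).summable.norm
  obtain ⟨G, hFG, hG⟩ : ∃ G : Finset S, F ⊆ G ∧ ∑' s : {s // s ∉ G}, ‖b s * f₀ s‖ < κ :=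
    (((tendsto_order.mp (tendsto_tsum_compl_atTop_zero fun s : S => ‖b s * f₀ s‖)).2 κ hκ).and
      (Filter.eventually_ge_atTop F)).exists.imp fun G h => ⟨h.2, h.1⟩
  set F' : Finset S := F.filter fun s => (s : E) ∈ Metric.ball t 1 with hF'
  have hsum : ∑ s ∈ F, (Metric.ball t 1).indicator (fun x => ‖b x‖ₑ) (s : E) =
      ∑ s ∈ F', ‖b s‖ₑ := by
    rw [hF', Finset.sum_filter]
    exact Finset.sum_congr rfl fun s _ => by rw [Set.indicator_apply]
  -- Conjugate phase of the mass; it is 0 where the mass vanishes, by `0 / 0 = 0`.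
  let p : E → ℂ := fun x => (starRingEnd ℂ) (b x) / ‖b x‖
  have hp (x : E) : ‖p x‖ ≤ 1 := by
    simp only [p, norm_div, Complex.norm_real, norm_norm, RCLike.norm_conj]
    exact div_self_le_one _
  have hbp (x : E) : b x * p x = ‖b x‖ := by
    simp only [p]
    rw [← mul_div_assoc, Complex.mul_conj', sq]
    by_cases h0 : (‖b x‖ : ℂ) = 0
    · simp [h0]
    · field_simp
  obtain ⟨f, hfs, hf1, hfF, hfG⟩ := exists_cc_interpolation (Metric.isOpen_ball (x := t) (ε := 1))
    (F'.image (↑)) (G.image (↑)) (by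
      intro x hx
      obtain ⟨s, hs, rfl⟩ := Finset.mem_image.mp hx
      exact (Finset.mem_filter.mp hs).2) p hp
  have hff₀ (x : E) : ‖b x * f x‖ ≤ ‖b x * f₀ x‖ := by
    rw [norm_mul, norm_mul]
    gcongr
    by_cases hx : x ∈ Metric.ball t 1
    · exact (hf1 x).trans (hf₀ x hx)
    · rw [image_eq_zero_of_notMem_tsupport fun hx' => hx (hfs hx'), norm_zero]
      exact norm_nonneg _
  have hfsum := h.2 f
  have hsf := hfsum.summable.norm
  have hGsum : ∑ s ∈ G, b s * f s = ((∑ s ∈ F', ‖b s‖ : ℝ) : ℂ) := by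
    push_cast
    have hsub : F' ⊆ G := (Finset.filter_subset _ _).trans hFG
    rw [← Finset.sum_subset hsub]
    · refine Finset.sum_congr rfl fun s hs => ?_
      rw [hfF s (Finset.mem_image_of_mem _ hs), hbp]
    · intro s hs hsF
      rw [hfG s (Finset.mem_image_of_mem _ hs) fun h' => ?_, mul_zero]
      obtain ⟨s', hs', he⟩ := Finset.mem_image.mp h'
      exact hsF (Subtype.ext he ▸ hs')
  have htail : ‖∑' s : {s // s ∉ G}, b s * f s‖ ≤ κ := by
    have hs1 : Summable fun s : {s // s ∉ G} => ‖b s * f s‖ :=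
      hsf.comp_injective Subtype.val_injective
    have hs2 : Summable fun s : {s // s ∉ G} => ‖b s * f₀ s‖ :=
      hs₀.comp_injective Subtype.val_injective
    exact (norm_tsum_le_tsum_norm hs1).trans
      ((Summable.tsum_le_tsum (fun s : {s // s ∉ G} => hff₀ s) hs1 hs2).trans hG.le)
  have hmain : ∑ s ∈ F', ‖b s‖ ≤ ‖ν.integral f‖ + κ := by
    have e := hfsum.summable.sum_add_tsum_subtype_compl G
    rw [hfsum.tsum_eq, hGsum] at e
    have e' : ((∑ s ∈ F', ‖b s‖ : ℝ) : ℂ) =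
        ν.integral f - ∑' s : {s // s ∉ G}, b s * f s := eq_sub_of_add_eq e
    calc ∑ s ∈ F', ‖b s‖ = ‖((∑ s ∈ F', ‖b s‖ : ℝ) : ℂ)‖ := by
          rw [Complex.norm_real, Real.norm_of_nonneg (Finset.sum_nonneg fun _ _ => norm_nonneg _)]
      _ ≤ ‖ν.integral f‖ + κ := by
          rw [e']
          exact (norm_sub_le _ _).trans (by gcongr)
  have hvar : ‖ν.integral f‖ₑ ≤ ν.variation ⟨Metric.ball t 1, Metric.isOpen_ball⟩ :=
    le_iSup₂_of_le f hfs (le_iSup_of_le hf1 le_rfl)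
  rw [hsum]
  refine le_trans ?_ (add_le_add hvar le_rfl)
  have : ∑ s ∈ F', ‖b s‖₊ ≤ ‖ν.integral f‖₊ + κ := by
    rw [← NNReal.coe_le_coe]
    push_cast
    exact hmain
  simpa [enorm_eq_nnnorm] using (by exact_mod_cast this :
    ((∑ s ∈ F', ‖b s‖₊ : ℝ≥0) : ℝ≥0∞) ≤ ((‖ν.integral f‖₊ + κ : ℝ≥0) : ℝ≥0∞))

/-- The masses of a translation bounded sum of atoms are summable against the translates of a
polynomially decaying weight, uniformly in the translation. -/
theorem IsSumOfAtoms.exists_tsum_weight_le {E : Type*} [NormedAddCommGroup E]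
    [InnerProductSpace ℝ E] [FiniteDimensional ℝ E]
    {ν : ComplexRadonMeasure E} {S : Set E} {b : E → ℂ} (h : ν.IsSumOfAtoms S b)
    (hb : ν.IsTranslationBounded) :
    ∃ K : ℝ, 0 ≤ K ∧ ∀ y : E,
      Summable (fun s : S => ‖b s‖ * ((1 + ‖(s : E) + y‖) ^ (Module.finrank ℝ E + 1))⁻¹) ∧
      ∑' s : S, ‖b s‖ * ((1 + ‖(s : E) + y‖) ^ (Module.finrank ℝ E + 1))⁻¹ ≤ K := by
  obtain ⟨C, hC⟩ := hb
  set k := Module.finrank ℝ E + 1 with hk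
  let _ : MeasurableSpace E := borel E
  have : BorelSpace E := ⟨rfl⟩
  have : Countable S := h.1.to_subtype
  let w : E → ℝ≥0∞ := fun x => ENNReal.ofReal (((1 + ‖x‖) ^ k)⁻¹)
  have hw : Measurable w := by fun_prop
  set I : ℝ≥0∞ := ∫⁻ x, w x with hI
  have hIfin : I < ∞ := by
    have := finite_integral_one_add_norm (E := E) (μ := MeasureTheory.volume) (r := (k : ℝ))
      (by rw [hk]; push_cast; linarith)
    convert this using 5 with x
    rw [Real.rpow_neg (by positivity), Real.rpow_natCast]
  set V : ℝ≥0∞ := MeasureTheory.volume (Metric.ball (0 : E) 1) with hV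
  have hV0 : V ≠ 0 := (Metric.measure_ball_pos _ _ one_pos).ne'
  have hVfin : V ≠ ∞ := MeasureTheory.measure_ball_lt_top.ne
  have hwle (s x y : E) (hx : x ∈ Metric.ball s 1) : w (s + y) ≤ 2 ^ k * w (x + y) := by
    have h1 : 1 + ‖x + y‖ ≤ 2 * (1 + ‖s + y‖) := by
      have : ‖x + y‖ ≤ ‖x - s‖ + ‖s + y‖ := by
        calc ‖x + y‖ = ‖(x - s) + (s + y)‖ := by congr 1; abel
          _ ≤ _ := norm_add_le _ _
      rw [Metric.mem_ball, dist_eq_norm] at hx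
      linarith [norm_nonneg (s + y)]
    have h2 : ((1 + ‖s + y‖) ^ k)⁻¹ ≤ 2 ^ k * ((1 + ‖x + y‖) ^ k)⁻¹ := by
      rw [← inv_inv ((2 : ℝ) ^ k), ← mul_inv]
      apply inv_anti₀ (by positivity)
      rw [inv_mul_le_iff₀ (by positivity), ← mul_pow]
      gcongr
    calc w (s + y) ≤ ENNReal.ofReal (2 ^ k * ((1 + ‖x + y‖) ^ k)⁻¹) := ENNReal.ofReal_le_ofReal h2
      _ = _ := by
        rw [ENNReal.ofReal_mul (by positivity), ENNReal.ofReal_pow (by norm_num)]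
        simp [w]
  -- The weight at `s` is at most `2 ^ k` times its value anywhere in the unit ball about `s`.
  -- Integrating over that ball and exchanging sum and integral leaves the masses in the unit ball
  -- about `x`, at most `C`. The exponent `k`, dimension plus one, makes `I` finite.
  have hmain (y : E) : (∑' s : S, ‖b s‖ₑ * w (s + y)) * V ≤ 2 ^ k * (C * I) := by
    calc (∑' s : S, ‖b s‖ₑ * w (s + y)) * V
        = ∑' s : S, ∫⁻ x, (Metric.ball (s : E) 1).indicator (fun _ => ‖b s‖ₑ * w (s + y)) x := by
          rw [← ENNReal.tsum_mul_right]
          refine tsum_congr fun s => ?_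
          rw [MeasureTheory.lintegral_indicator_const Metric.isOpen_ball.measurableSet,
            MeasureTheory.Measure.addHaar_ball_center]
      _ = ∫⁻ x, ∑' s : S, (Metric.ball (s : E) 1).indicator (fun _ => ‖b s‖ₑ * w (s + y)) x := by
          rw [MeasureTheory.lintegral_tsum]
          exact fun s => (measurable_const.indicator Metric.isOpen_ball.measurableSet).aemeasurable
      _ ≤ ∫⁻ x, 2 ^ k * (C * w (x + y)) := by
          refine MeasureTheory.lintegral_mono fun x => ?_
          calc ∑' s : S, (Metric.ball (s : E) 1).indicator (fun _ => ‖b s‖ₑ * w (s + y)) x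
              ≤ ∑' s : S, (Metric.ball x 1).indicator (fun z => ‖b z‖ₑ) (s : E)
                  * (2 ^ k * w (x + y)) := by
                refine ENNReal.tsum_le_tsum fun s => ?_
                by_cases hx : x ∈ Metric.ball (s : E) 1
                · rw [Set.indicator_of_mem hx,
                    Set.indicator_of_mem (Metric.mem_ball_comm.mp hx)]
                  gcongr
                  exact hwle s x y hx
                · rw [Set.indicator_of_notMem hx]
                  exact zero_le
            _ ≤ C * (2 ^ k * w (x + y)) := by
                rw [ENNReal.tsum_mul_right]
                gcongr
                exact (h.tsum_enorm_le_variation x).trans (hC x)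
            _ = 2 ^ k * (C * w (x + y)) := by ring
      _ = 2 ^ k * (C * I) := by
          rw [MeasureTheory.lintegral_const_mul _ (by fun_prop),
            MeasureTheory.lintegral_const_mul _ (by fun_prop),
            MeasureTheory.lintegral_add_right_eq_self w y]
  set K : ℝ≥0∞ := 2 ^ k * (C * I) / V with hK
  have hKfin : K ≠ ∞ := by
    refine ENNReal.div_ne_top ?_ hV0
    exact ENNReal.mul_ne_top (by simp) (ENNReal.mul_ne_top (by simp) hIfin.ne)
  have hle (y : E) : ∑' s : S, ‖b s‖ₑ * w (s + y) ≤ K :=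
    (ENNReal.le_div_iff_mul_le (.inl hV0) (.inl hVfin)).mpr (hmain y)
  have heq (y : E) (s : S) : ENNReal.ofReal (‖b s‖ * ((1 + ‖(s : E) + y‖) ^ k)⁻¹) =
      ‖b s‖ₑ * w (s + y) := by
    rw [ENNReal.ofReal_mul (norm_nonneg _), ofReal_norm]
  refine ⟨K.toReal, ENNReal.toReal_nonneg, fun y => ?_⟩
  have hne : ∑' s : S, ENNReal.ofReal (‖b s‖ * ((1 + ‖(s : E) + y‖) ^ k)⁻¹) ≠ ∞ := by
    simp_rw [heq]
    exact ne_top_of_le_ne_top hKfin (hle y)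
  have hnn (s : S) : 0 ≤ ‖b s‖ * ((1 + ‖(s : E) + y‖) ^ k)⁻¹ := by positivity
  have hs : Summable fun s : S => ‖b s‖ * ((1 + ‖(s : E) + y‖) ^ k)⁻¹ := by
    have := ENNReal.summable_toReal hne
    simpa only [ENNReal.toReal_ofReal (hnn _)] using this
  refine ⟨hs, ?_⟩
  rw [← ENNReal.ofReal_le_iff_le_toReal hKfin, ENNReal.ofReal_tsum_of_nonneg hnn hs]
  simp_rw [heq]
  exact hle y

end ComplexRadonMeasure

/-! ### From compactly supported to Schwartz test functions -/

section SchwartzCutoff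

variable {E : Type*} [NormedAddCommGroup E] [NormedSpace ℝ E]

theorem SchwartzMap.exists_norm_le_weight (f : 𝓢(E, ℂ)) (k : ℕ) :
    ∃ K : ℝ, 0 ≤ K ∧ ∀ x, ‖f x‖ ≤ K * ((1 + ‖x‖) ^ k)⁻¹ := by
  refine ⟨2 ^ k * (Finset.Iic (k, 0)).sup (fun m => SchwartzMap.seminorm ℂ m.1 m.2) f,
    by positivity, fun x => ?_⟩
  rw [← div_eq_mul_inv, le_div_iff₀ (by positivity), mul_comm]
  simpa using SchwartzMap.one_add_le_sup_seminorm_apply (𝕜 := ℂ) (m := (k, 0)) (k := k) (n := 0)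
    le_rfl le_rfl f x

/-- Multiplying a Schwartz function by dilations of a function which is smooth, compactly supported,
and equal to one near the origin, converges to the function in the Schwartz space. -/
theorem SchwartzMap.exists_tendsto_hasCompactSupport [FiniteDimensional ℝ E] [HasContDiffBump E]
    (f : 𝓢(E, ℂ)) :
    ∃ g : ℕ → 𝓢(E, ℂ), (∀ m, HasCompactSupport (g m)) ∧ (∀ m x, ‖g m x‖ ≤ ‖f x‖) ∧
      (∀ x, Filter.Tendsto (fun m => g m x) Filter.atTop (nhds (f x))) ∧
      Filter.Tendsto g Filter.atTop (nhds f) := by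
  let β : ContDiffBump (0 : E) := ⟨1, 2, one_pos, one_lt_two⟩
  let χ : E → ℂ := fun x => (β x : ℂ)
  have hχ : ContDiff ℝ (⊤ : ℕ∞) χ := Complex.ofRealCLM.contDiff.comp β.contDiff
  have hχc : HasCompactSupport χ := β.hasCompactSupport.comp_left (g := Complex.ofReal) rfl
  have hχ1 (x : E) (hx : ‖x‖ ≤ 1) : χ x = 1 := by
    simp only [χ, β.one_of_mem_closedBall (by simpa using hx), Complex.ofReal_one]
  have hχle (x : E) : ‖χ x‖ ≤ 1 := by
    simp only [χ, Complex.norm_real, Real.norm_of_nonneg β.nonneg]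
    exact β.le_one
  let θ : E → ℂ := fun x => χ x - 1
  have hθ : ContDiff ℝ (⊤ : ℕ∞) θ := hχ.sub contDiff_const
  have hθb (i : ℕ) : ∃ C : ℝ, 0 ≤ C ∧ ∀ x, ‖iteratedFDeriv ℝ i θ x‖ ≤ C := by
    let χS : 𝓢(E, ℂ) := hχc.toSchwartzMap hχ
    have h1 : iteratedFDeriv ℝ i θ = iteratedFDeriv ℝ i χ - iteratedFDeriv ℝ i (fun _ => (1 : ℂ)) :=
      iteratedFDeriv_sub (hχ.of_le (mod_cast le_top)) contDiff_const
    refine ⟨SchwartzMap.seminorm ℝ 0 i χS + 1, by positivity, fun x => ?_⟩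
    rw [h1]
    refine (norm_sub_le _ _).trans (add_le_add (χS.norm_iteratedFDeriv_le_seminorm ℝ i x) ?_)
    rcases eq_or_ne i 0 with rfl | hi
    · simp
    · simp [iteratedFDeriv_const_of_ne hi]
  choose Cθ hCθ0 hCθ using hθb
  let sc : ℕ → ℝ := fun m => ((m : ℝ) + 1)⁻¹
  have hsc0 (m : ℕ) : 0 < sc m := by positivity
  have hsc1 (m : ℕ) : sc m ≤ 1 := inv_le_one_of_one_le₀ (by linarith [m.cast_nonneg (α := ℝ)])
  have hsct : Filter.Tendsto sc Filter.atTop (nhds 0) := by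
    simpa [sc] using tendsto_one_div_add_atTop_nhds_zero_nat (𝕜 := ℝ)
  have hgc (m : ℕ) : HasCompactSupport fun x => χ (sc m • x) * f x :=
    (hχc.comp_smul (hsc0 m).ne').mul_right
  have hgd (m : ℕ) : ContDiff ℝ (⊤ : ℕ∞) fun x => χ (sc m • x) * f x :=
    (hχ.comp (contDiff_const_smul _)).mul f.smooth'
  have hθd (m : ℕ) : ContDiff ℝ (⊤ : ℕ∞) fun x => θ (sc m • x) := hθ.comp (contDiff_const_smul _)
  refine ⟨fun m => (hgc m).toSchwartzMap (hgd m), hgc, fun m x => ?_, fun x => ?_, ?_⟩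
  · change ‖χ (sc m • x) * f x‖ ≤ _
    rw [norm_mul]
    exact mul_le_of_le_one_left (norm_nonneg _) (hχle _)
  · change Filter.Tendsto (fun m => χ (sc m • x) * f x) _ _
    have h1 : Filter.Tendsto (fun m => χ (sc m • x)) Filter.atTop (nhds (χ ((0 : ℝ) • x))) :=
      (hχ.continuous.tendsto _).comp (hsct.smul_const x)
    rw [zero_smul, hχ1 0 (by simp)] at h1
    simpa using h1.mul_const (f x)
  · rw [(schwartz_withSeminorms ℝ E ℂ).tendsto_nhds_atTop]
    rintro ⟨k, n⟩ ε hε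
    let M : ℝ := ∑ i ∈ Finset.range (n + 1),
      (n.choose i : ℝ) * Cθ i * SchwartzMap.seminorm ℝ (k + 1) (n - i) f
    have hM : 0 ≤ M := Finset.sum_nonneg fun i _ => by have := hCθ0 i; positivity
    have hbound (m : ℕ) :
        SchwartzMap.seminorm ℝ k n ((hgc m).toSchwartzMap (hgd m) - f) ≤ sc m * M := by
      refine SchwartzMap.seminorm_le_bound ℝ k n _ (mul_nonneg (hsc0 m).le hM) fun x => ?_
      have hfun : (((hgc m).toSchwartzMap (hgd m) - f : 𝓢(E, ℂ)) : E → ℂ) =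
          fun x => θ (sc m • x) * f x := by
        funext x
        change χ (sc m • x) * f x - f x = (χ (sc m • x) - 1) * f x
        ring
      rw [hfun]
      -- `θ` vanishes on the unit ball, so only points with `1 ≤ sc m * ‖x‖` matter. Inserting this
      -- factor gains `sc m` at the price of one more power of `‖x‖`, that is, the seminorm of index
      -- `k + 1`.
      have hterm (i : ℕ) : ‖x‖ ^ k * ((n.choose i : ℝ) *
          ‖iteratedFDeriv ℝ i (fun x => θ (sc m • x)) x‖ * ‖iteratedFDeriv ℝ (n - i) f x‖) ≤
          sc m * ((n.choose i : ℝ) * Cθ i * SchwartzMap.seminorm ℝ (k + 1) (n - i) f) := by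
        rw [iteratedFDeriv_comp_const_smul _ (hθ.of_le (mod_cast le_top)), norm_smul]
        by_cases hx : ‖sc m • x‖ < 1
        · have h0 : iteratedFDeriv ℝ i θ (sc m • x) = 0 := by
            have : θ =ᶠ[nhds (sc m • x)] fun _ => 0 := by
              filter_upwards [(continuous_norm.isOpen_preimage _ isOpen_Iio).mem_nhds hx] with z hz
              simp only [θ, hχ1 z (le_of_lt hz), sub_self]
            rw [(this.iteratedFDeriv ℝ i).eq_of_nhds]
            simp
          rw [h0, norm_zero]
          have := hCθ0 i
          have := hsc0 m
          simp only [mul_zero, zero_mul]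
          positivity
        · rw [norm_smul, Real.norm_of_nonneg (hsc0 m).le, not_lt] at hx
          have h1 : ‖sc m ^ i‖ ≤ 1 := by
            rw [norm_pow, Real.norm_of_nonneg (hsc0 m).le]
            exact pow_le_one₀ (hsc0 m).le (hsc1 m)
          have h2 := f.le_seminorm ℝ (k + 1) (n - i) x
          have := hCθ0 i
          calc ‖x‖ ^ k * ((n.choose i : ℝ) * (‖sc m ^ i‖ * ‖iteratedFDeriv ℝ i θ (sc m • x)‖) *
                ‖iteratedFDeriv ℝ (n - i) f x‖)
              ≤ (‖x‖ ^ k * (sc m * ‖x‖)) * ((n.choose i : ℝ) * (1 * Cθ i) *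
                ‖iteratedFDeriv ℝ (n - i) f x‖) := by
                gcongr
                · exact le_mul_of_one_le_right (by positivity) hx
                · exact hCθ i _
            _ = sc m * ((n.choose i : ℝ) * Cθ i *
                (‖x‖ ^ (k + 1) * ‖iteratedFDeriv ℝ (n - i) f x‖)) := by ring
            _ ≤ _ := by
                have := hsc0 m
                gcongr
      calc ‖x‖ ^ k * ‖iteratedFDeriv ℝ n (fun x => θ (sc m • x) * f x) x‖
          ≤ ‖x‖ ^ k * ∑ i ∈ Finset.range (n + 1), (n.choose i : ℝ) *
          ‖iteratedFDeriv ℝ i (fun x => θ (sc m • x)) x‖ * ‖iteratedFDeriv ℝ (n - i) f x‖ := by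
            gcongr
            exact norm_iteratedFDeriv_mul_le (hθd m) f.smooth' x (mod_cast le_top)
        _ ≤ sc m * M := by
            rw [Finset.mul_sum, Finset.mul_sum]
            exact Finset.sum_le_sum fun i _ => hterm i
    have hlim : Filter.Tendsto (fun m => sc m * M) Filter.atTop (nhds 0) := by
      simpa using hsct.mul_const M
    obtain ⟨m₀, hm₀⟩ := Filter.eventually_atTop.mp ((tendsto_order.mp hlim).2 ε hε)
    exact ⟨m₀, fun m hm => (hbound m).trans_lt (hm₀ m hm)⟩

/-- A tempered distribution which is a sum of atoms with masses summable against a polynomially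
decaying weight is given by the same sum on all Schwartz functions. -/
theorem TemperedDistribution.IsMeasure.hasSum [FiniteDimensional ℝ E] [HasContDiffBump E]
    {T : 𝓢'(E, ℂ)} {ν : ComplexRadonMeasure E} (hT : T.IsMeasure ν) {S : Set E} {b : E → ℂ}
    (h : ν.IsSumOfAtoms S b) (k : ℕ)
    (hb : Summable fun s : S => ‖b s‖ * ((1 + ‖(s : E)‖) ^ k)⁻¹) (f : 𝓢(E, ℂ)) :
    HasSum (fun s : S => b s * f s) (T f) := by
  obtain ⟨g, hgc, hgle, hgp, hgt⟩ := f.exists_tendsto_hasCompactSupport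
  obtain ⟨K, hK, hfK⟩ := f.exists_norm_le_weight k
  have hs : Summable fun s : S => ‖b s‖ * ‖f s‖ := by
    refine (hb.mul_left K).of_nonneg_of_le (fun s => by positivity) fun s => ?_
    calc ‖b s‖ * ‖f s‖ ≤ ‖b s‖ * (K * ((1 + ‖(s : E)‖) ^ k)⁻¹) := by gcongr; exact hfK _
      _ = _ := by ring
  have h1 : Filter.Tendsto (fun m => ∑' s : S, b s * g m s) Filter.atTop
      (nhds (∑' s : S, b s * f s)) := by
    refine tendsto_tsum_of_dominated_convergence hs (fun s => (hgp _).const_mul _)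
      (Filter.Eventually.of_forall fun m s => ?_)
    rw [norm_mul]
    gcongr
    exact hgle _ _
  have h2 : Filter.Tendsto (fun m => T (g m)) Filter.atTop (nhds (T f)) :=
    ((map_continuous T).tendsto f).comp hgt
  have h3 (m : ℕ) : T (g m) = ∑' s : S, b s * g m s := by
    rw [hT _ (hgc m)]
    exact (h.2 _).tsum_eq.symm
  simp_rw [h3] at h2
  rw [tendsto_nhds_unique h2 h1]
  exact (Summable.of_norm (by simpa using hs)).hasSum

end SchwartzCutoff

/-! ### Localizing a single frequency -/

section Localization

variable {E : Type*} [NormedAddCommGroup E] [InnerProductSpace ℝ E]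

/-- The exponential `x ↦ e^{2π i ⟨x, l⟩}` with frequency `l`, as a character. -/
noncomputable def expChar (l : E) : AddChar E ℂ where
  toFun x := Complex.exp (2 * Real.pi * Complex.I * (inner ℝ x l : ℝ))
  map_zero_eq_one' := by simp
  map_add_eq_mul' x y := by
    rw [← Complex.exp_add, inner_add_left]
    push_cast
    ring_nf

theorem expChar_apply (l x : E) :
    expChar l x = Complex.exp (2 * Real.pi * Complex.I * (inner ℝ x l : ℝ)) := rfl

theorem norm_expChar (l x : E) : ‖expChar l x‖ = 1 := by
  rw [expChar_apply, show 2 * (Real.pi : ℂ) * Complex.I * (inner ℝ x l : ℝ) =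
    ((2 * Real.pi * inner ℝ x l : ℝ) : ℂ) * Complex.I by push_cast; ring,
    Complex.norm_exp_ofReal_mul_I]

theorem contDiff_expChar (l : E) : ContDiff ℝ (⊤ : ℕ∞) (expChar l) := by
  have : (expChar l : E → ℂ) =
      fun x => Complex.exp (2 * Real.pi * Complex.I * (inner ℝ x l : ℝ)) := rfl
  rw [this]
  exact (contDiff_const.mul (Complex.ofRealCLM.contDiff.comp
    (contDiff_id.inner ℝ contDiff_const))).cexp

theorem expChar_comm (l x : E) : expChar l x = expChar x l := by
  rw [expChar_apply, expChar_apply, real_inner_comm]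

/-- Substituting `ξ = v + l` merges all phases into `⟨v, x + y⟩ + ⟨l, x + y⟩`. -/
theorem fourierInv_expChar_mul_comp_sub [FiniteDimensional ℝ E] [MeasurableSpace E] [BorelSpace E]
    (φ : E → ℂ) (l y x : E) :
    𝓕⁻ (fun ξ => expChar y ξ * φ (ξ - l)) x = 𝓕⁻ φ (x + y) * expChar l (x + y) := by
  rw [Real.fourierInv_eq', Real.fourierInv_eq', ← MeasureTheory.integral_mul_const,
    ← MeasureTheory.integral_add_right_eq_self _ l]
  refine MeasureTheory.integral_congr_ae (Filter.Eventually.of_forall fun v => ?_)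
  simp only [add_sub_cancel_right, smul_eq_mul, expChar_apply]
  rw [← mul_assoc, ← Complex.exp_add, mul_right_comm _ (φ v), ← Complex.exp_add]
  congr 2
  simp only [inner_add_left, inner_add_right, real_inner_comm l]
  push_cast
  ring

/-- Poisson-type formula obtained from `(𝓕 T) (𝓕⁻ f) = T f`. As `𝓕⁻ f` need not have compact
support, the atomic expansion of `𝓕 T` is needed on all Schwartz functions. -/
theorem TemperedDistribution.IsMeasure.hasSum_fourierInv [FiniteDimensional ℝ E]
    [MeasurableSpace E] [BorelSpace E] {μ ν : ComplexRadonMeasure E} {T : 𝓢'(E, ℂ)}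
    (hT : T.IsMeasure μ) (hν : (𝓕 T).IsMeasure ν) {S : Set E} {b : E → ℂ}
    (hνS : ν.IsSumOfAtoms S b) (k : ℕ)
    (hb : Summable fun s : S => ‖b s‖ * ((1 + ‖(s : E)‖) ^ k)⁻¹)
    (f : 𝓢(E, ℂ)) (hf : HasCompactSupport f) :
    HasSum (fun s : S => b s * (𝓕⁻ f : 𝓢(E, ℂ)) s) (μ.integral (f.toCc hf)) := by
  have h1 := hν.hasSum hνS k hb (𝓕⁻ f)
  have h2 : (𝓕 T) (𝓕⁻ f) = μ.integral (f.toCc hf) := by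
    rw [TemperedDistribution.fourier_apply, FourierTransform.fourier_fourierInv_eq, hT _ hf]
  rwa [h2] at h1

/-- Localization in the frequency variable: an exponential with frequency an atom of `μ` is, up to
the mass of the atom, the convolution of the Fourier transform of `μ` with a localized
exponential. -/
theorem exists_schwartz_localization [FiniteDimensional ℝ E] [MeasurableSpace E] [BorelSpace E]
    {Λ : Set E} {a : E → ℂ} {μ ν : ComplexRadonMeasure E} {T : 𝓢'(E, ℂ)}
    (hΛ : IsUniformlyDiscrete Λ) (hμ : μ.IsSumOfAtoms Λ a) (hT : T.IsMeasure μ)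
    (hν : (𝓕 T).IsMeasure ν) {S : Set E} {b : E → ℂ} (hνS : ν.IsSumOfAtoms S b) (k : ℕ)
    (hb : Summable fun s : S => ‖b s‖ * ((1 + ‖(s : E)‖) ^ k)⁻¹) :
    ∃ ψ : 𝓢(E, ℂ), ∀ l ∈ Λ, ∀ y : E,
      HasSum (fun s : S => b s * (ψ (s + y) * expChar l (s + y))) (a l * expChar l y) := by
  obtain ⟨δ, hδ, hΛδ⟩ := hΛ
  -- Outer radius `δ`, the separation constant: centred at a point of `Λ`, the bump vanishes at all
  -- other points of `Λ`.
  let β : ContDiffBump (0 : E) := ⟨δ / 2, δ, by positivity, by linarith⟩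
  let φ : E → ℂ := fun x => (β x : ℂ)
  have hφ : ContDiff ℝ (⊤ : ℕ∞) φ := Complex.ofRealCLM.contDiff.comp β.contDiff
  have hφc : HasCompactSupport φ := β.hasCompactSupport.comp_left (g := Complex.ofReal) rfl
  have hφ0 : φ 0 = 1 := by
    simp only [φ, β.one_of_mem_closedBall (Metric.mem_closedBall_self β.rIn_pos.le),
      Complex.ofReal_one]
  have hφz (x : E) (hx : δ ≤ ‖x‖) : φ x = 0 := by
    simp only [φ, β.zero_of_le_dist (x := x) (by simpa using hx), Complex.ofReal_zero]
  refine ⟨𝓕⁻ (hφc.toSchwartzMap hφ), fun l hl y => ?_⟩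
  let Φ : E → ℂ := fun ξ => expChar y ξ * φ (ξ - l)
  have hΦ : ContDiff ℝ (⊤ : ℕ∞) Φ :=
    (contDiff_expChar y).mul (hφ.comp (contDiff_id.sub contDiff_const))
  have hΦc : HasCompactSupport Φ := by
    refine HasCompactSupport.mul_left ?_
    exact hφc.comp_homeomorph (Homeomorph.subRight l)
  let Φs : 𝓢(E, ℂ) := hΦc.toSchwartzMap hΦ
  have h1 := hT.hasSum_fourierInv hν hνS k hb Φs hΦc
  have h2 : μ.integral (Φs.toCc hΦc) = a l * expChar l y := by
    refine (hμ.2 _).unique ?_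
    have h3 := hasSum_single (f := fun x : Λ => a x * Φ x) ⟨l, hl⟩ fun x hx => by
      have hne : (x : E) ≠ l := fun h => hx (Subtype.ext h)
      have := hΛδ x x.2 l hl hne
      rw [dist_eq_norm] at this
      simp only [Φ, hφz _ this, mul_zero]
    have h4 : Φ l = expChar l y := by
      simp only [Φ, sub_self, hφ0, mul_one]
      exact expChar_comm y l
    exact h4 ▸ h3
  rw [h2] at h1
  refine (funext fun s : S => ?_ : (fun s : S => b s * _) = _) ▸ h1
  rw [SchwartzMap.fourierInv_coe, SchwartzMap.fourierInv_coe]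
  exact congrArg (b s * ·) (fourierInv_expChar_mul_comp_sub φ l y s).symm

end Localization

/-! ### Bohr almost periodicity of exponential sums -/

section BohrAlmostPeriodic

variable {E : Type*} [NormedAddCommGroup E] [InnerProductSpace ℝ E]

/-- A pigeonhole argument: the vectors `(e_l x)` for `l ∈ F` form a totally bounded set, so each `x`
agrees up to `η` with one of finitely many points `p y`. The difference `x - p y` is then an almost
period, and `R` bounds the `‖p y‖`. -/
theorem exists_almostPeriod_expChar (F : Finset E) {η : ℝ} (hη : 0 < η) :
    ∃ R : ℝ, 0 < R ∧ ∀ x : E, ∃ τ ∈ Metric.closedBall x R, ∀ l ∈ F, ‖expChar l τ - 1‖ ≤ η := by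
  let Φ : E → (F → ℂ) := fun x l => expChar (l : E) x
  have htb : TotallyBounded (Set.range Φ) := by
    refine (isCompact_closedBall (0 : F → ℂ) 1).totallyBounded.subset ?_
    rintro _ ⟨x, rfl⟩
    rw [mem_closedBall_zero_iff, pi_norm_le_iff_of_nonneg zero_le_one]
    exact fun l => (norm_expChar _ _).le
  obtain ⟨t, ht, htf, hcov⟩ := Metric.finite_approx_of_totallyBounded htb η hη
  choose! p hp using fun y (hy : y ∈ t) => ht hy
  obtain ⟨R, hR⟩ := (htf.image fun y => ‖p y‖).bddAbove
  refine ⟨max R 1, lt_max_of_lt_right one_pos, fun x => ?_⟩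
  obtain ⟨y, hy, hxy⟩ := Set.mem_iUnion₂.mp (hcov ⟨x, rfl⟩)
  refine ⟨x - p y, ?_, fun l hl => ?_⟩
  · rw [Metric.mem_closedBall, dist_eq_norm, sub_sub_cancel_left, norm_neg]
    exact (hR ⟨y, hy, rfl⟩).trans (le_max_left _ _)
  · have h1 : expChar l x - expChar l (p y) = (expChar l (x - p y) - 1) * expChar l (p y) := by
      rw [sub_mul, one_mul, ← AddChar.map_add_eq_mul, sub_add_cancel]
    have h2 : ‖expChar l x - expChar l (p y)‖ ≤ η := by
      rw [← hp y hy, Metric.mem_ball] at hxy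
      exact ((dist_eq_norm _ _).symm.le.trans (dist_le_pi_dist (Φ x) (Φ (p y)) ⟨l, hl⟩)).trans hxy.le
    rwa [h1, norm_mul, norm_expChar, mul_one] at h2

theorem expSum_eq_sum {U : Set E} (c : U →₀ ℂ) (x : E) :
    expSum c x = ∑ l ∈ c.support, c l * expChar (l : E) x := rfl

theorem continuous_expSum {U : Set E} (c : U →₀ ℂ) : Continuous (expSum c) := by
  have : expSum c = fun x => ∑ l ∈ c.support, c l * expChar (l : E) x := rfl
  rw [this]
  exact continuous_finsetSum _ fun l _ => continuous_const.mul (contDiff_expChar (l : E)).continuous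

theorem isBohrAlmostPeriodic_expSum {U : Set E} (c : U →₀ ℂ) : IsBohrAlmostPeriodic (expSum c) := by
  classical
  refine ⟨continuous_expSum c, fun η hη => ?_⟩
  set N : ℝ := ∑ l ∈ c.support, ‖c l‖ + 1 with hN
  have hN0 : 0 < N := by positivity
  obtain ⟨R, hR, h⟩ := exists_almostPeriod_expChar (c.support.image ((↑) : U → E))
    (show 0 < η / N by positivity)
  refine ⟨R, hR, fun x => ?_⟩
  obtain ⟨τ, hτ, hτl⟩ := h x
  refine ⟨τ, hτ, fun t => ?_⟩
  rw [expSum_eq_sum, expSum_eq_sum, ← Finset.sum_sub_distrib]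
  calc ‖∑ l ∈ c.support, (c l * expChar (l : E) (t + τ) - c l * expChar (l : E) t)‖
      ≤ ∑ l ∈ c.support, ‖c l‖ * (η / N) := by
        refine norm_sum_le_of_le _ fun l hl => ?_
        have : c l * expChar (l : E) (t + τ) - c l * expChar (l : E) t =
            c l * (expChar (l : E) t * (expChar (l : E) τ - 1)) := by
          rw [AddChar.map_add_eq_mul]
          ring
        rw [this, norm_mul, norm_mul, norm_expChar, one_mul]
        gcongr
        exact hτl _ (Finset.mem_image_of_mem _ hl)
    _ = (N - 1) * (η / N) := by rw [← Finset.sum_mul, hN]; ring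
    _ ≤ N * (η / N) := by gcongr; linarith
    _ = η := by field_simp

theorem IsBohrAlmostPeriodic.of_tendstoUniformly {E : Type*} [NormedAddCommGroup E]
    {F : ℕ → E → ℂ} {f : E → ℂ}
    (hF : ∀ n, IsBohrAlmostPeriodic (F n)) (h : TendstoUniformly F f Filter.atTop) :
    IsBohrAlmostPeriodic f := by
  refine ⟨h.continuous (Filter.Frequently.of_forall fun n => (hF n).1), fun η hη => ?_⟩
  obtain ⟨n, hn⟩ := (Metric.tendstoUniformly_iff.mp h (η / 3) (by positivity)).exists
  obtain ⟨R, hR, hτ⟩ := (hF n).2 (η / 3) (by positivity)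
  refine ⟨R, hR, fun x => (hτ x).imp fun τ h => ⟨h.1, fun t => ?_⟩⟩
  have h1 := hn (t + τ)
  have h2 := hn t
  have h3 := h.2 t
  rw [← dist_eq_norm] at h3 ⊢
  rw [dist_comm] at h2
  linarith [dist_triangle4 (f (t + τ)) (F n (t + τ)) (F n t) (f t)]

end BohrAlmostPeriodic

/-! ### The closed span of exponentials and its norm estimate -/

section ExponentialSpan

open BoundedContinuousFunction

variable {E : Type*} [NormedAddCommGroup E]

/-- Translation of bounded continuous functions. -/
noncomputable def translationCLM (x : E) : (E →ᵇ ℂ) →L[ℂ] (E →ᵇ ℂ) :=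
  LinearMap.mkContinuous
    { toFun := fun f => f.compContinuous ⟨fun y => y + x, by fun_prop⟩
      map_add' := fun _ _ => rfl
      map_smul' := fun _ _ => rfl } 1 fun f => by
    rw [one_mul]
    exact (norm_le (norm_nonneg f)).mpr fun y => f.norm_coe_le_norm _

theorem norm_translationCLM_le (x : E) : ‖translationCLM x‖ ≤ 1 :=
  LinearMap.mkContinuous_norm_le _ zero_le_one _

variable [InnerProductSpace ℝ E]

/-- The exponential with frequency `l` as a bounded continuous function. -/
noncomputable def expBCF (l : E) : E →ᵇ ℂ :=
  ofNormedAddCommGroup (expChar l) (contDiff_expChar l).continuous 1 fun x => (norm_expChar l x).le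

/-- The uniform closure of the trigonometric polynomials with frequencies in `U`. -/
noncomputable def expSpan (U : Set E) : Submodule ℂ (E →ᵇ ℂ) :=
  (Submodule.span ℂ (Set.range fun l : U => expBCF (l : E))).topologicalClosure

theorem isClosed_expSpan (U : Set E) : IsClosed (expSpan U : Set (E →ᵇ ℂ)) :=
  Submodule.isClosed_topologicalClosure _

instance (U : Set E) : CompleteSpace (expSpan U) := (isClosed_expSpan U).completeSpace_coe

/-- The exponential with frequency `l ∈ U` as an element of `expSpan U`. -/
noncomputable def expVec {U : Set E} (l : U) : expSpan U :=
  ⟨expBCF (l : E), Submodule.le_topologicalClosure _ (Submodule.subset_span ⟨l, rfl⟩)⟩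

theorem expVec_total (U : Set E) :
    (Submodule.span ℂ (Set.range (expVec (U := U)))).topologicalClosure = ⊤ := by
  refine eq_top_iff.mpr fun x _ => ?_
  change x ∈ closure (Submodule.span ℂ (Set.range (expVec (U := U))) : Set (expSpan U))
  rw [closure_subtype]
  have h : (Subtype.val '' (Submodule.span ℂ (Set.range (expVec (U := U))) : Set (expSpan U))) =
      (Submodule.span ℂ (Set.range fun l : U => expBCF (l : E)) : Set (E →ᵇ ℂ)) := by
    change ((Submodule.map (expSpan U).subtype _ : Submodule ℂ (E →ᵇ ℂ)) : Set (E →ᵇ ℂ)) = _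
    rw [Submodule.map_span, ← Set.range_comp]
    rfl
  rw [h]
  exact x.2

theorem translationCLM_expBCF (x l : E) : translationCLM x (expBCF l) = expChar l x • expBCF l := by
  ext y
  change expChar l (y + x) = expChar l x * expChar l y
  rw [AddChar.map_add_eq_mul, mul_comm]

theorem translationCLM_mem_expSpan {U : Set E} (x : E) {f : E →ᵇ ℂ} (hf : f ∈ expSpan U) :
    translationCLM x f ∈ expSpan U := by
  have h : expSpan U ≤ (expSpan U).comap (translationCLM x : (E →ᵇ ℂ) →ₗ[ℂ] (E →ᵇ ℂ)) := by
    refine Submodule.topologicalClosure_minimal _ ?_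
      ((isClosed_expSpan U).preimage (translationCLM x).continuous)
    rw [Submodule.span_le]
    rintro _ ⟨l, rfl⟩
    change translationCLM x (expBCF (l : E)) ∈ expSpan U
    rw [translationCLM_expBCF]
    exact Submodule.smul_mem _ _ (expVec l).2
  exact h hf

/-- The translations as operators on `expSpan U`. -/
noncomputable def expSpanTranslation (U : Set E) : AddChar E (expSpan U →L[ℂ] expSpan U) where
  toFun x := ((translationCLM x).comp (expSpan U).subtypeL).codRestrict (expSpan U)
    fun f => translationCLM_mem_expSpan x f.2
  map_zero_eq_one' := by
    ext f y
    exact congrArg (f : E →ᵇ ℂ) (add_zero y)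
  map_add_eq_mul' x x' := by
    ext f y
    change (f : E →ᵇ ℂ) (y + (x + x')) = (f : E →ᵇ ℂ) (y + x + x')
    rw [add_assoc]

theorem expSpanTranslation_apply {U : Set E} (x y : E) (f : expSpan U) :
    (expSpanTranslation U x f : E →ᵇ ℂ) y = (f : E →ᵇ ℂ) (y + x) := rfl

theorem norm_expSpanTranslation_le (U : Set E) (x : E) : ‖expSpanTranslation U x‖ ≤ 1 := by
  refine ContinuousLinearMap.opNorm_le_bound _ zero_le_one fun f => ?_
  exact (translationCLM x).le_of_opNorm_le (norm_translationCLM_le x) (f : E →ᵇ ℂ)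

theorem expSpanTranslation_expVec {U : Set E} (x : E) (l : U) :
    expSpanTranslation U x (expVec l) = expChar (l : E) x • expVec l :=
  Subtype.ext (translationCLM_expBCF x l)

/-- Evaluation at a point as a functional on `expSpan U`. -/
noncomputable def expSpanEval (U : Set E) (x : E) : expSpan U →L[ℂ] ℂ :=
  (evalCLM ℂ x).comp (expSpan U).subtypeL

theorem expSpanEval_apply {U : Set E} (x : E) (f : expSpan U) :
    expSpanEval U x f = (f : E →ᵇ ℂ) x := rfl

theorem norm_expSpanEval_le (U : Set E) (x : E) : ‖expSpanEval U x‖ ≤ 1 :=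
  ContinuousLinearMap.opNorm_le_bound _ zero_le_one fun f => by
    rw [one_mul]
    exact (f : E →ᵇ ℂ).norm_coe_le_norm x

theorem hasSum_tsum_smul_expSpanTranslation_apply {U : Set E} {S : Type*} {w : S → ℂ}
    (hw : Summable fun s => ‖w s‖) (p : S → E) (f : expSpan U) (y : E) :
    HasSum (fun s => w s * (f : E →ᵇ ℂ) (y + p s))
      ((((∑' s, w s • expSpanTranslation U (p s)) f : expSpan U) : E →ᵇ ℂ) y) := by
  let L : (expSpan U →L[ℂ] expSpan U) →L[ℂ] ℂ :=
    (expSpanEval U y).comp (ContinuousLinearMap.apply ℂ (expSpan U) f)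
  have hL (A : expSpan U →L[ℂ] expSpan U) : L A = ((A f : expSpan U) : E →ᵇ ℂ) y := rfl
  have h := hasSum_smul_map_of_norm_le_one hw (v := fun s => expSpanTranslation U (p s))
    (fun s => norm_expSpanTranslation_le U (p s)) L
  simp only [hL, expSpanTranslation_apply, smul_eq_mul] at h
  exact h

theorem hasSum_tsum_smul_expSpanEval_apply {U : Set E} {S : Type*} {w : S → ℂ}
    (hw : Summable fun s => ‖w s‖) (p : S → E) (f : expSpan U) :
    HasSum (fun s => w s * (f : E →ᵇ ℂ) (p s)) ((∑' s, w s • expSpanEval U (p s)) f) := by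
  let L : (expSpan U →L[ℂ] ℂ) →L[ℂ] ℂ := ContinuousLinearMap.apply ℂ ℂ f
  have hL (A : expSpan U →L[ℂ] ℂ) : L A = A f := rfl
  have h := hasSum_smul_map_of_norm_le_one hw (v := fun s => expSpanEval U (p s))
    (fun s => norm_expSpanEval_le U (p s)) L
  simp only [hL, expSpanEval_apply, smul_eq_mul] at h
  exact h

/-- Two absolutely convergent averages which multiply each exponential with frequency in `U` by the
same number agree on `expSpan U`. -/
theorem hasSum_localized_of_hasSum_expChar {U : Set E} {a : E → ℂ} {S : Type*} {w w' : S → ℂ}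
    (hw : Summable fun s => ‖w s‖) (hw' : Summable fun s => ‖w' s‖) (p p' : S → E) (y : E)
    (h : ∀ l ∈ U, HasSum (fun s => w s * expChar l (p s)) (a l))
    (h' : ∀ l ∈ U, HasSum (fun s => w' s * expChar l (p' s)) (a l * expChar l y))
    (f : expSpan U) :
    HasSum (fun s => w' s * (f : E →ᵇ ℂ) (p' s))
      ((((∑' s, w s • expSpanTranslation U (p s)) f : expSpan U) : E →ᵇ ℂ) y) := by
  have hLM : ∑' s, w' s • expSpanEval U (p' s) =
      (expSpanEval U y).comp (∑' s, w s • expSpanTranslation U (p s)) := by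
    refine ContinuousLinearMap.ext_of_total (expVec_total U) fun l => ?_
    refine (hasSum_tsum_smul_expSpanEval_apply hw' p' (expVec l)).unique ?_
    have h1 : a l * expChar (l : E) y =
        (((∑' s, w s • expSpanTranslation U (p s)) (expVec l) : expSpan U) : E →ᵇ ℂ) y := by
      refine ((h l l.2).mul_right (expChar (l : E) y)).unique ?_
      have h2 := hasSum_tsum_smul_expSpanTranslation_apply hw p (expVec l) y
      refine (funext fun s => ?_ : (fun s => w s * _) = fun s => _) ▸ h2
      change w s * expChar (l : E) (y + p s) = _
      rw [AddChar.map_add_eq_mul]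
      ring
    change HasSum _ ((((∑' s, w s • expSpanTranslation U (p s)) (expVec l) : expSpan U) :
      E →ᵇ ℂ) y)
    rw [← h1]
    exact h' l l.2
  have h3 := hasSum_tsum_smul_expSpanEval_apply hw' p' f
  rw [hLM] at h3
  exact h3

/-- The sup norm of a function with frequencies in `U` is controlled by its values on a ball, if
the exponentials with frequencies in `U` are localized by a Schwartz function and masses which are
uniformly summable against the translates of a polynomially decaying weight. -/
theorem exists_norm_le_of_localization {U : Set E} {a : E → ℂ} {S : Set E} {b : E → ℂ} (k : ℕ)
    {K : ℝ} (hK : 0 ≤ K)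
    (hb : ∀ y : E, Summable (fun s : S => ‖b s‖ * ((1 + ‖(s : E) + y‖) ^ k)⁻¹) ∧
      ∑' s : S, ‖b s‖ * ((1 + ‖(s : E) + y‖) ^ k)⁻¹ ≤ K)
    (ψ : 𝓢(E, ℂ))
    (hψ : ∀ l ∈ U, ∀ y : E,
      HasSum (fun s : S => b s * (ψ (s + y) * expChar l (s + y))) (a l * expChar l y))
    {ε : ℝ} (hε : 0 < ε) (ha : ∀ l ∈ U, ε ≤ ‖a l‖) :
    ∃ C R : ℝ, 0 ≤ C ∧ 0 ≤ R ∧ ∀ (f : expSpan U) (m : ℝ),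
      (∀ x ∈ Metric.closedBall (0 : E) R, ‖(f : E →ᵇ ℂ) x‖ ≤ m) → ‖f‖ ≤ C * m := by
  -- One power more than summability requires: the spare factor `(1 + ‖x‖)⁻¹` makes the contribution
  -- far from the origin small.
  obtain ⟨Kψ, hKψ, hψK⟩ := ψ.exists_norm_le_weight (k + 1)
  have hw (x : E) : ((1 + ‖x‖) ^ (k + 1))⁻¹ = ((1 + ‖x‖) ^ k)⁻¹ * (1 + ‖x‖)⁻¹ := by
    rw [pow_succ, mul_inv]
  have hw1 (x : E) : (1 + ‖x‖)⁻¹ ≤ 1 := inv_le_one_of_one_le₀ (by linarith [norm_nonneg x])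
  have hψK' (x : E) : ‖ψ x‖ ≤ Kψ * ((1 + ‖x‖) ^ k)⁻¹ := by
    refine (hψK x).trans ?_
    rw [hw]
    gcongr
    exact mul_le_of_le_one_right (by positivity) (hw1 x)
  have hsum (y : E) : Summable fun s : S => ‖b s * ψ (s + y)‖ := by
    refine ((hb y).1.mul_left Kψ).of_nonneg_of_le (fun _ => norm_nonneg _) fun s => ?_
    rw [norm_mul]
    calc ‖b s‖ * ‖ψ (s + y)‖ ≤ ‖b s‖ * (Kψ * ((1 + ‖(s : E) + y‖) ^ k)⁻¹) := by
          gcongr; exact hψK' _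
      _ = _ := by ring
  have hsum0 : Summable fun s : S => ‖b s * ψ s‖ := by simpa using hsum 0
  have hψ0 (l : U) : HasSum (fun s : S => b s * ψ s * expChar (l : E) s) (a l) := by
    have := hψ l l.2 0
    simpa [AddChar.map_zero_eq_one, mul_assoc] using this
  set M : expSpan U →L[ℂ] expSpan U := ∑' s : S, (b s * ψ s) • expSpanTranslation U s with hM
  have hMunit : IsUnit M :=
    isUnit_tsum_smul_of_le_norm_eigenvalue (expVec_total U) (expSpanTranslation U)
      (norm_expSpanTranslation_le U) (fun l : U => expChar (l : E)) (fun l x => norm_expChar _ x)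
      (fun l x => expSpanTranslation_expVec x l) (fun s : S => b s * ψ s) hsum0
      (fun s : S => (s : E)) hε fun l => by
        rw [(hψ0 l).tsum_eq]
        exact ha l l.2
  obtain ⟨N, hN⟩ := hMunit.exists_left_inv
  -- Recentring: `M` was defined by averaging `f` around `y`, but here `M f y` is an average of `f`
  -- around the origin, for every `y`.
  have hLapply (y : E) (f : expSpan U) :
      HasSum (fun s : S => b s * ψ (s + y) * (f : E →ᵇ ℂ) (s + y)) ((M f : E →ᵇ ℂ) y) :=
    hasSum_localized_of_hasSum_expChar hsum0 (hsum y) (fun s : S => (s : E))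
      (fun s : S => (s : E) + y) y (fun l hl => hψ0 ⟨l, hl⟩)
      (fun l hl => by simpa only [mul_assoc] using hψ l hl y) f
  set A : ℝ := ‖N‖ * (Kψ * K) with hA
  have hA0 : 0 ≤ A := by positivity
  -- The radius `2 * A` gives `A * (1 + 2 * A)⁻¹ ≤ 1 / 2`, so the part outside the ball is at most
  -- `‖f‖ / 2`; absorbing it doubles the constant `A`.
  refine ⟨2 * A, 2 * A, by positivity, by positivity, fun f m hfm => ?_⟩
  have hm : 0 ≤ m := (norm_nonneg _).trans (hfm 0 (Metric.mem_closedBall_self (by positivity)))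
  -- Bounds `(1 + ‖x‖)⁻¹ * ‖f x‖` everywhere: the first summand suffices inside the ball, the second
  -- outside.
  set q : ℝ := m + ‖f‖ * (1 + 2 * A)⁻¹ with hq
  have hq0 : 0 ≤ q := by positivity
  have hpt (x : E) : ‖ψ x‖ * ‖(f : E →ᵇ ℂ) x‖ ≤ Kψ * q * ((1 + ‖x‖) ^ k)⁻¹ := by
    have h1 : (1 + ‖x‖)⁻¹ * ‖(f : E →ᵇ ℂ) x‖ ≤ q := by
      by_cases hx : x ∈ Metric.closedBall (0 : E) (2 * A)
      · calc (1 + ‖x‖)⁻¹ * ‖(f : E →ᵇ ℂ) x‖ ≤ 1 * m := by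
              gcongr
              · exact hw1 x
              · exact hfm x hx
          _ ≤ q := by rw [one_mul, hq]; exact le_add_of_nonneg_right (by positivity)
      · rw [mem_closedBall_zero_iff, not_le] at hx
        calc (1 + ‖x‖)⁻¹ * ‖(f : E →ᵇ ℂ) x‖ ≤ (1 + 2 * A)⁻¹ * ‖f‖ := by
              gcongr
              exact (f : E →ᵇ ℂ).norm_coe_le_norm x
          _ ≤ q := by rw [hq, mul_comm]; exact le_add_of_nonneg_left hm
    calc ‖ψ x‖ * ‖(f : E →ᵇ ℂ) x‖
        ≤ Kψ * (((1 + ‖x‖) ^ k)⁻¹ * (1 + ‖x‖)⁻¹) * ‖(f : E →ᵇ ℂ) x‖ := by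
          gcongr
          exact hw x ▸ hψK x
      _ = Kψ * ((1 + ‖x‖) ^ k)⁻¹ * ((1 + ‖x‖)⁻¹ * ‖(f : E →ᵇ ℂ) x‖) := by ring
      _ ≤ Kψ * ((1 + ‖x‖) ^ k)⁻¹ * q := by gcongr
      _ = _ := by ring
  have hMf : ‖M f‖ ≤ Kψ * q * K := by
    refine (norm_le (f := (M f : E →ᵇ ℂ)) (by positivity)).mpr fun y => ?_
    rw [← (hLapply y f).tsum_eq]
    have h2 := (hb y).1.mul_left (Kψ * q)
    have h3 (s : S) : ‖b s * ψ (s + y) * (f : E →ᵇ ℂ) (s + y)‖ ≤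
        Kψ * q * (‖b s‖ * ((1 + ‖(s : E) + y‖) ^ k)⁻¹) := by
      rw [norm_mul, norm_mul, mul_assoc]
      calc _ ≤ ‖b s‖ * (Kψ * q * ((1 + ‖(s : E) + y‖) ^ k)⁻¹) :=
            mul_le_mul_of_nonneg_left (hpt _) (norm_nonneg _)
        _ = _ := by ring
    refine (tsum_of_norm_bounded h2.hasSum h3).trans ?_
    rw [tsum_mul_left]
    gcongr
    exact (hb y).2
  have hf : ‖f‖ ≤ ‖N‖ * ‖M f‖ := by
    have : f = N (M f) := by
      change f = (N * M) f
      rw [hN]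
      rfl
    calc ‖f‖ = ‖N (M f)‖ := by rw [← this]
      _ ≤ _ := N.le_opNorm _
  have h3 : ‖f‖ ≤ A * m + ‖f‖ / 2 := by
    have h4 : A * (1 + 2 * A)⁻¹ ≤ 1 / 2 := by
      rw [← div_eq_mul_inv, div_le_div_iff₀ (by positivity) two_pos]
      linarith
    calc ‖f‖ ≤ ‖N‖ * (Kψ * q * K) := hf.trans (by gcongr)
      _ = A * m + ‖f‖ * (A * (1 + 2 * A)⁻¹) := by rw [hA, hq]; ring
      _ ≤ A * m + ‖f‖ * (1 / 2) := by gcongr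
      _ = _ := by ring
  linarith

/-- A trigonometric polynomial with frequencies in `U` as an element of `expSpan U`. -/
noncomputable def expSumVec {U : Set E} (c : U →₀ ℂ) : expSpan U := c.sum fun l z => z • expVec l

theorem expSumVec_apply {U : Set E} (c : U →₀ ℂ) (x : E) :
    (expSumVec c : E →ᵇ ℂ) x = expSum c x := by
  rw [expSum_eq_sum]
  change expSpanEval U x (∑ l ∈ c.support, c l • expVec l) = _
  rw [map_sum]
  rfl

/-- Applied to differences of the sums, the estimate turns uniform convergence on one ball into the
Cauchy property in the sup norm. The limit in `expSpan U` agrees pointwise with `f`. -/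
theorem isCoherentSetOfFrequencies_of_norm_le [ProperSpace E] {U : Set E}
    (hU : IsUniformlyDiscrete U) {C R : ℝ} (hC : 0 ≤ C)
    (h : ∀ (f : expSpan U) (m : ℝ),
      (∀ x ∈ Metric.closedBall (0 : E) R, ‖(f : E →ᵇ ℂ) x‖ ≤ m) → ‖f‖ ≤ C * m) :
    IsCoherentSetOfFrequencies U := by
  refine ⟨hU, fun c f hcf => ?_⟩
  refine IsBohrAlmostPeriodic.of_tendstoUniformly (fun n => isBohrAlmostPeriodic_expSum (c n)) ?_
  have hcauchy : CauchySeq fun n => expSumVec (c n) := by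
    rw [Metric.cauchySeq_iff]
    intro ε hε
    have hε' : 0 < ε / (2 * (C + 1)) := by positivity
    obtain ⟨N, hN⟩ := Filter.eventually_atTop.mp
      (Metric.tendstoUniformlyOn_iff.mp (hcf _ (isCompact_closedBall 0 R)) _ hε')
    refine ⟨N, fun n hn m hm => ?_⟩
    rw [dist_eq_norm]
    have := h (expSumVec (c n) - expSumVec (c m)) (2 * (ε / (2 * (C + 1)))) fun x hx => by
      change ‖(expSumVec (c n) : E →ᵇ ℂ) x - (expSumVec (c m) : E →ᵇ ℂ) x‖ ≤ _
      rw [expSumVec_apply, expSumVec_apply, ← dist_eq_norm]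
      have h1 := hN n hn x hx
      have h2 := hN m hm x hx
      linarith [dist_triangle_left (expSum (c n) x) (expSum (c m) x) (f x)]
    refine this.trans_lt ?_
    calc C * (2 * (ε / (2 * (C + 1)))) < (C + 1) * (2 * (ε / (2 * (C + 1)))) := by
          gcongr
          linarith
      _ = ε := by field_simp
  obtain ⟨g, hg⟩ := cauchySeq_tendsto_of_complete hcauchy
  have hg' : Filter.Tendsto (fun n => (expSumVec (c n) : E →ᵇ ℂ)) Filter.atTop
      (nhds (g : E →ᵇ ℂ)) := (continuous_subtype_val.tendsto g).comp hg
  have hu := tendsto_iff_tendstoUniformly.mp hg'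
  have hcoe (n : ℕ) : ((expSumVec (c n) : E →ᵇ ℂ) : E → ℂ) = expSum (c n) :=
    funext fun x => expSumVec_apply _ _
  simp only [hcoe] at hu
  have hfg : f = (g : E →ᵇ ℂ) := funext fun x =>
    tendsto_nhds_unique ((hcf {x} isCompact_singleton).tendsto_at (Set.mem_singleton x))
      (hu.tendsto_at x)
  rwa [hfg]

end ExponentialSpan

theorem mainTheorem2 (d : ℕ)
    (Λ : Set (EuclideanSpace ℝ (Fin d))) (a : EuclideanSpace ℝ (Fin d) → ℂ)
    (μ ν : ComplexRadonMeasure (EuclideanSpace ℝ (Fin d)))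
    (T : 𝓢'(EuclideanSpace ℝ (Fin d), ℂ))
    (hΛ : IsUniformlyDiscrete Λ)
    (hμ : μ.IsSumOfAtoms Λ a)
    (hT : T.IsMeasure μ)
    (hν : (𝓕 T).IsMeasure ν)
    (hνa : ν.IsAtomic)
    (hνb : ν.IsTranslationBounded) :
    ∀ ε : ℝ, 0 < ε → IsCoherentSetOfFrequencies {x | x ∈ Λ ∧ ε ≤ ‖a x‖} := by
  intro ε hε
  obtain ⟨S, b, hS⟩ := hνa
  obtain ⟨K, hK, hb⟩ := hS.exists_tsum_weight_le hνb
  obtain ⟨ψ, hψ⟩ := exists_schwartz_localization hΛ hμ hT hν hS _ (by simpa using (hb 0).1)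
  obtain ⟨C, R, hC, -, h⟩ := exists_norm_le_of_localization (U := {x | x ∈ Λ ∧ ε ≤ ‖a x‖}) _ hK hb ψ
    (fun l hl y => hψ l hl.1 y) hε fun l hl => hl.2
  obtain ⟨δ, hδ, hΛδ⟩ := hΛ
  exact isCoherentSetOfFrequencies_of_norm_le
    ⟨δ, hδ, fun x hx y hy hxy => hΛδ x hx.1 y hy.1 hxy⟩ hC h
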